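/- Let $n\ge 3$ and let $$M=\mathbb{S}^n_+=\{(x_1,\dots,x_{n+1})\in\mathbb{R}^{n+1} : x_1^2+\cdots+x_{n+1}^2=1,\ x_{n+1}\ge 0\}$$ be the closed upper hemisphere, with boundary $\partial M=\{x_{n+1}=0\}\cap M$, equipped with the standard metric $g_c$ induced by the Euclidean metric of $\mathbb{R}^{n+1}$. For a smooth Riemannian metric $g$ on $M$ with induced boundary metric $\gamma=g|_{\partial M}$, let $R_g$ be the scalar curvature of $g$ and let $H_\gamma=\mathrm{tr}_\gamma II_\gamma$ be the mean curvature of $\partial M$, where $II_\gamma(X,Y)=g(\nabla_X\nu,Y)$ and $\nu$ is the outward unit normal. Put $\Psi(g)=(R_g,2H_\gamma)$, and for a smooth symmetric $2$-tensor $h$ on $M$ let $$\mathcal{S}_g(h)=\left.\tfrac{d}{dt}\right|_{t=0}\Psi(g+th)=(\delta R_g h,\,2\,\delta H_\gamma h).$$ Let $\mathcal{S}_g^*$ be the $L^2$-formal adjoint of $\mathcal{S}_g$: $\mathcal{S}^*_g(f_1,f_2)=(A,B)$, with $A$ a smooth symmetric $2$-tensor on $M$ and $B$ a smooth symmetric $2$-tensor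 on $\partial M$, means that for all smooth symmetric $2$-tensors $h$ on $M$ $$\int_M(\delta R_g h)f_1\,dV_g+\int_{\partial M}(2\,\delta H_\gamma h)f_2\,dA_\gamma=\int_M\langle h,A\rangle_g\,dV_g+\int_{\partial M}\langle h,B\rangle_\gamma\,dA_\gamma .$$ Write $\mathcal{S}^*_g(f)=\mathcal{S}^*_g(f,f)$ for $f\in C^\infty(M)$. The metric $g$ is called singular if $\ker\mathcal{S}^*_g=\{f\in C^\infty(M):\mathcal{S}^*_g(f)=0\}\ne\{0\}$. Then $g_c$ is singular, and moreover $$\ker\mathcal{S}^*_{g_c}=\mathrm{span}_{\mathbb{R}}\{x_1,\dots,x_n\},$$ where $x_1,\dots,x_n$ are the restrictions to $\mathbb{S}^n_+$ of the coordinate functions of $\mathbb{R}^{n+1}$ other than $x_{n+1}$. -/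

import Mathlib

open Metric MeasureTheory
open scoped ContDiff

noncomputable section

namespace Hemisphere

/-- The closed upper hemisphere `{x ∈ ℝ^{n+1} : |x| = 1, x_{n+1} ≥ 0}`. -/
def upper (n : ℕ) : Set (EuclideanSpace ℝ (Fin (n + 1))) :=
  {x | ‖x‖ = 1 ∧ 0 ≤ x (Fin.last n)}

/-- The closed unit ball of `ℝⁿ`, the image of the (global) stereographic chart of the upper
hemisphere, projecting from the south pole.  The unit sphere corresponds to the equator. -/
abbrev disc (n : ℕ) : Set (EuclideanSpace ℝ (Fin n)) := closedBall 0 1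

/-- The inverse `y ↦ (2 y, 1 - |y|²) / (1 + |y|²)` of the stereographic chart. -/
def param (n : ℕ) (y : EuclideanSpace ℝ (Fin n)) : EuclideanSpace ℝ (Fin (n + 1)) :=
  WithLp.toLp 2 (Fin.snoc (α := fun _ => ℝ) (fun i => 2 * y i / (1 + ‖y‖ ^ 2))
    ((1 - ‖y‖ ^ 2) / (1 + ‖y‖ ^ 2)))

lemma param_castSucc {n : ℕ} (y : EuclideanSpace ℝ (Fin n)) (i : Fin n) :
    param n y i.castSucc = 2 * y i / (1 + ‖y‖ ^ 2) := by
  simp [param]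

lemma param_last {n : ℕ} (y : EuclideanSpace ℝ (Fin n)) :
    param n y (Fin.last n) = (1 - ‖y‖ ^ 2) / (1 + ‖y‖ ^ 2) := by
  simp [param]

lemma param_mem {n : ℕ} {y : EuclideanSpace ℝ (Fin n)} (hy : y ∈ disc n) :
    param n y ∈ upper n := by
  have hy1 : ‖y‖ ≤ 1 := by simpa using hy
  have hpos : 0 < 1 + ‖y‖ ^ 2 := by positivity
  refine ⟨?_, ?_⟩
  · have hs : ∑ i, (y i) ^ 2 = ‖y‖ ^ 2 := (EuclideanSpace.real_norm_sq_eq y).symm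
    have h : ‖param n y‖ ^ 2 = 1 := by
      rw [EuclideanSpace.real_norm_sq_eq, Fin.sum_univ_castSucc]
      simp only [param_castSucc, param_last, div_pow, mul_pow]
      rw [← Finset.sum_div, ← Finset.mul_sum, hs]
      field_simp
      ring
    nlinarith [norm_nonneg (param n y)]
  · rw [param_last]
    exact div_nonneg (by nlinarith [norm_nonneg y]) hpos.le

/-- The closed unit ball parametrizes the whole upper hemisphere. -/
lemma param_bijOn (n : ℕ) : Set.BijOn (param n) (disc n) (upper n) := by
  refine ⟨fun y hy => param_mem hy, ?_, ?_⟩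
  · intro y _ z _ h
    have hy : 0 < 1 + ‖y‖ ^ 2 := by positivity
    have hz : 0 < 1 + ‖z‖ ^ 2 := by positivity
    have hl := congrArg (fun x : EuclideanSpace ℝ (Fin (n + 1)) => x (Fin.last n)) h
    simp only [param_last] at hl
    rw [div_eq_div_iff hy.ne' hz.ne'] at hl
    have hn : ‖y‖ ^ 2 = ‖z‖ ^ 2 := by nlinarith
    ext i
    have hi := congrArg (fun x : EuclideanSpace ℝ (Fin (n + 1)) => x i.castSucc) h
    simp only [param_castSucc, hn] at hi
    field_simp at hi
    linarith
  · rintro x ⟨hx, hx0⟩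
    set c := x (Fin.last n) with hc
    have hc1 : 0 < 1 + c := by linarith
    have hsum : ∑ i : Fin n, (x i.castSucc) ^ 2 = 1 - c ^ 2 := by
      have := EuclideanSpace.real_norm_sq_eq x
      rw [hx, Fin.sum_univ_castSucc] at this
      linarith
    let y : EuclideanSpace ℝ (Fin n) := WithLp.toLp 2 fun i => x i.castSucc / (1 + c)
    have hy : ‖y‖ ^ 2 = (1 - c) / (1 + c) := by
      rw [EuclideanSpace.real_norm_sq_eq]
      simp only [y, div_pow]
      rw [← Finset.sum_div, hsum]
      field_simp
      ring
    have hs : 1 + ‖y‖ ^ 2 = 2 / (1 + c) := by rw [hy]; field_simp; ring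
    refine ⟨y, ?_, ?_⟩
    · have : ‖y‖ ^ 2 ≤ 1 := by rw [hy, div_le_one hc1]; linarith
      simpa using (sq_le_one_iff₀ (norm_nonneg y)).mp this
    · ext j
      refine Fin.lastCases ?_ (fun i => ?_) j
      · rw [param_last, hs, hy]
        field_simp
        linarith
      · rw [param_castSucc, hs]
        simp only [y]
        field_simp

/-- A function on the hemisphere read in the stereographic chart (`0` outside the chart image). -/
def inChart {n : ℕ} (f : upper n → ℝ) (y : EuclideanSpace ℝ (Fin n)) : ℝ :=
  open Classical in if hy : y ∈ disc n then f ⟨param n y, param_mem hy⟩ else 0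

/-- Membership in `C^∞` of the hemisphere, as a manifold with boundary. -/
def IsSmooth {n : ℕ} (f : upper n → ℝ) : Prop :=
  ContDiffOn ℝ ∞ (inChart f) (disc n)

/-- A 2-tensor field on the hemisphere, through its components `h_{ij}` in the stereographic
chart; only the values on `disc n` matter. -/
abbrev Tensor (n : ℕ) : Type := EuclideanSpace ℝ (Fin n) → Matrix (Fin n) (Fin n) ℝ

/-- Smooth (up to the boundary) symmetric 2-tensor fields. -/
def IsSmoothSymm {n : ℕ} (h : Tensor n) : Prop :=
  (∀ i j, ContDiffOn ℝ ∞ (fun y => h y i j) (disc n)) ∧ ∀ y ∈ disc n, (h y).IsSymm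

/-- Partial derivative `∂_i F`, one-sided at the boundary. -/
def pd {n : ℕ} (i : Fin n) (F : EuclideanSpace ℝ (Fin n) → ℝ) (y : EuclideanSpace ℝ (Fin n)) : ℝ :=
  fderivWithin ℝ F (disc n) y (EuclideanSpace.single i 1)

/-- Christoffel symbols `Γ^k_{ij} = ½ g^{kl} (∂_i g_{lj} + ∂_j g_{li} - ∂_l g_{ij})`. -/
def christoffel {n : ℕ} (g : Tensor n) (k i j : Fin n) (y : EuclideanSpace ℝ (Fin n)) : ℝ :=
  1 / 2 * ∑ l, (g y)⁻¹ k l *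
    (pd i (fun z => g z l j) y + pd j (fun z => g z l i) y - pd l (fun z => g z i j) y)

/-- Ricci tensor
`R_{ij} = ∂_k Γ^k_{ij} - ∂_j Γ^k_{ik} + Γ^k_{kl} Γ^l_{ij} - Γ^k_{jl} Γ^l_{ik}`. -/
def ricci {n : ℕ} (g : Tensor n) (i j : Fin n) (y : EuclideanSpace ℝ (Fin n)) : ℝ :=
  ∑ k, (pd k (christoffel g k i j) y - pd j (christoffel g k i k) y) +
    ∑ k, ∑ l, (christoffel g k k l y * christoffel g l i j y -
      christoffel g k j l y * christoffel g l i k y)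

/-- Scalar curvature `R_g = g^{ij} R_{ij}`. -/
def scalarCurvature {n : ℕ} (g : Tensor n) (y : EuclideanSpace ℝ (Fin n)) : ℝ :=
  ∑ i, ∑ j, (g y)⁻¹ i j * ricci g i j y

/-- Outward unit normal `ν^k = g^{kl} y_l / (g^{ab} y_a y_b)^{1/2}` along the boundary `|y| = 1`,
whose outward conormal is `y`, extended to the punctured ball by the same formula. -/
def normal {n : ℕ} (g : Tensor n) (k : Fin n) (y : EuclideanSpace ℝ (Fin n)) : ℝ :=
  (∑ l, (g y)⁻¹ k l * y l) / √(∑ a, ∑ b, (g y)⁻¹ a b * y a * y b)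

/-- `II_{ij} = g(∇_{∂_i} ν, ∂_j)`.  The second fundamental form of the boundary with respect to
`ν` is the restriction of this bilinear form to vectors tangent to the boundary. -/
def secondForm {n : ℕ} (g : Tensor n) (i j : Fin n) (y : EuclideanSpace ℝ (Fin n)) : ℝ :=
  ∑ k, g y k j * (pd i (normal g k) y + ∑ l, christoffel g k i l y * normal g l y)

/-- Inverse `γ^{ij} = g^{ij} - ν^i ν^j` of the metric induced on the boundary. -/
def boundaryInv {n : ℕ} (g : Tensor n) (i j : Fin n) (y : EuclideanSpace ℝ (Fin n)) : ℝ :=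
  (g y)⁻¹ i j - normal g i y * normal g j y

/-- Mean curvature `H_γ = γ^{ij} II_{ij}` of the boundary. -/
def meanCurvature {n : ℕ} (g : Tensor n) (y : EuclideanSpace ℝ (Fin n)) : ℝ :=
  ∑ i, ∑ j, boundaryInv g i j y * secondForm g i j y

/-- First component of the linearization at `g` of `Ψ(g) = (R_g, 2 H_γ)`, in direction `h`. -/
def linScalar {n : ℕ} (g h : Tensor n) (y : EuclideanSpace ℝ (Fin n)) : ℝ :=
  deriv (fun t : ℝ => scalarCurvature (g + t • h) y) 0

/-- Second component of the linearization at `g` of `Ψ(g) = (R_g, 2 H_γ)`, in direction `h`. -/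
def linMean {n : ℕ} (g h : Tensor n) (y : EuclideanSpace ℝ (Fin n)) : ℝ :=
  deriv (fun t : ℝ => 2 * meanCurvature (g + t • h) y) 0

/-- `∫_M u dV_g`, with `dV_g = (det g)^{1/2} dy`. -/
def integralM {n : ℕ} (g : Tensor n) (u : EuclideanSpace ℝ (Fin n) → ℝ) : ℝ :=
  ∫ y in disc n, u y * √(g y).det

/-- `∫_{∂M} u dA_γ`.  The area form is the contraction of `dV_g` with `ν`, i.e.
`(det g)^{1/2} (ν · y)` times the Euclidean surface measure of the unit sphere. -/
def integralBoundary {n : ℕ} (g : Tensor n) (u : EuclideanSpace ℝ (Fin n) → ℝ) : ℝ :=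
  ∫ y : sphere (0 : EuclideanSpace ℝ (Fin n)) 1,
    u y * (√(g y).det * ∑ l, normal g l y * (y : EuclideanSpace ℝ (Fin n)) l)
    ∂(volume : Measure (EuclideanSpace ℝ (Fin n))).toSphere

/-- `⟨h, A⟩_g = g^{ik} g^{jl} h_{ij} A_{kl}`. -/
def innerM {n : ℕ} (g h A : Tensor n) (y : EuclideanSpace ℝ (Fin n)) : ℝ :=
  ∑ i, ∑ j, ∑ k, ∑ l, (g y)⁻¹ i k * (g y)⁻¹ j l * h y i j * A y k l

/-- `⟨h, B⟩_γ = γ^{ik} γ^{jl} h_{ij} B_{kl}`; it sees only the tangential parts. -/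
def innerBoundary {n : ℕ} (g h B : Tensor n) (y : EuclideanSpace ℝ (Fin n)) : ℝ :=
  ∑ i, ∑ j, ∑ k, ∑ l, boundaryInv g i k y * boundaryInv g j l y * h y i j * B y k l

/-- `S_g^*(f₁, f₂) = (A, B)`, where `S_g^*` is the `L²`-formal adjoint of the linearization
`S_g(h) = (δR_g h, 2 δH_γ h)`: for all smooth symmetric `h`,
`∫_M (δR_g h) f₁ dV_g + ∫_{∂M} (2 δH_γ h) f₂ dA_γ = ∫_M ⟨h, A⟩_g dV_g + ∫_{∂M} ⟨h, B⟩_γ dA_γ`. -/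
def AdjointEq {n : ℕ} (g : Tensor n) (f₁ f₂ : upper n → ℝ) (A B : Tensor n) : Prop :=
  IsSmoothSymm A ∧ IsSmoothSymm B ∧ ∀ h : Tensor n, IsSmoothSymm h →
    integralM g (fun y => linScalar g h y * inChart f₁ y) +
        integralBoundary g (fun y => linMean g h y * inChart f₂ y) =
      integralM g (innerM g h A) + integralBoundary g (innerBoundary g h B)

/-- The kernel of `f ↦ S_g^*(f) = S_g^*(f, f)` on smooth functions. -/
def kerAdjoint {n : ℕ} (g : Tensor n) : Set (upper n → ℝ) :=
  {f | IsSmooth f ∧ AdjointEq g f f 0 0}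

/-- The metric `g` is singular if `S_g^*` has a nonzero element in its kernel. -/
def IsSingular {n : ℕ} (g : Tensor n) : Prop :=
  ∃ f ∈ kerAdjoint g, f ≠ 0

/-- The standard metric of the hemisphere, induced by the Euclidean metric of `ℝ^{n+1}`. -/
def standardMetric (n : ℕ) : Tensor n := fun y =>
  Matrix.of fun i j => inner ℝ (fderiv ℝ (param n) y (EuclideanSpace.single i 1))
    (fderiv ℝ (param n) y (EuclideanSpace.single j 1))

/-- The coordinate functions `x_1, …, x_n` (without `x_{n+1}`) on the hemisphere. -/
def coord {n : ℕ} (i : Fin n) : upper n → ℝ := fun x => x.1 i.castSucc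

end Hemisphere

end

noncomputable section

namespace Hemisphere

variable {n : ℕ}

/-- Smoothness up to the boundary of a function given in the chart. -/
abbrev SmoothOnDisc (u : EuclideanSpace ℝ (Fin n) → ℝ) : Prop := ContDiffOn ℝ ∞ u (disc n)

lemma two_le_smooth : (2 : WithTop ℕ∞) ≤ ∞ := by
  have : ((2 : ℕ∞) : WithTop ℕ∞) ≤ ((⊤ : ℕ∞) : WithTop ℕ∞) := by
    exact_mod_cast (le_top : (2 : ℕ∞) ≤ ⊤)
  exact this

lemma uniqueDiffOn_disc : UniqueDiffOn ℝ (disc n) :=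
  uniqueDiffOn_convex (convex_closedBall _ _) ⟨0, by
    rw [interior_closedBall _ one_ne_zero]; simp⟩

lemma SmoothOnDisc.differentiableWithinAt {u : EuclideanSpace ℝ (Fin n) → ℝ}
    (hu : SmoothOnDisc u) {y : EuclideanSpace ℝ (Fin n)} (hy : y ∈ disc n) :
    DifferentiableWithinAt ℝ u (disc n) y :=
  (hu.differentiableOn (by simp)) y hy

lemma smoothOnDisc_coord (i : Fin n) :
    SmoothOnDisc (fun y : EuclideanSpace ℝ (Fin n) => y i) :=
  (EuclideanSpace.proj i : EuclideanSpace ℝ (Fin n) →L[ℝ] ℝ).contDiff.contDiffOn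

lemma SmoothOnDisc.pd {u : EuclideanSpace ℝ (Fin n) → ℝ} (hu : SmoothOnDisc u) (i : Fin n) :
    SmoothOnDisc (pd i u) :=
  (hu.fderivWithin uniqueDiffOn_disc (by simp)).clm_apply contDiffOn_const

lemma SmoothOnDisc.sum {ι : Type*} {s : Finset ι} {u : ι → EuclideanSpace ℝ (Fin n) → ℝ}
    (hu : ∀ a ∈ s, SmoothOnDisc (u a)) : SmoothOnDisc (fun y => ∑ a ∈ s, u a y) :=
  ContDiffOn.sum hu

lemma pd_congr {u v : EuclideanSpace ℝ (Fin n) → ℝ} (h : Set.EqOn u v (disc n)) (i : Fin n)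
    {y : EuclideanSpace ℝ (Fin n)} (hy : y ∈ disc n) : pd i u y = pd i v y := by
  rw [pd, pd, fderivWithin_congr h (h hy)]

lemma pd_const (c : ℝ) (i : Fin n) (y : EuclideanSpace ℝ (Fin n)) :
    pd i (fun _ => c) y = 0 := by
  simp [pd]

lemma pd_coord (i j : Fin n) {y : EuclideanSpace ℝ (Fin n)} (hy : y ∈ disc n) :
    pd i (fun z => z j) y = if i = j then 1 else 0 := by
  have := (EuclideanSpace.proj j : EuclideanSpace ℝ (Fin n) →L[ℝ] ℝ).hasFDerivAt (x := y)
  have h2 := this.hasFDerivWithinAt (s := disc n)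
  have h3 := h2.fderivWithin (uniqueDiffOn_disc y hy)
  simp only [pd]
  erw [h3]
  simp [eq_comm]

section rules

variable {u v : EuclideanSpace ℝ (Fin n) → ℝ} {y : EuclideanSpace ℝ (Fin n)}

lemma pd_add (i : Fin n) (hu : SmoothOnDisc u) (hv : SmoothOnDisc v) (hy : y ∈ disc n) :
    pd i (fun z => u z + v z) y = pd i u y + pd i v y := by
  simp only [pd]
  rw [fderivWithin_fun_add (uniqueDiffOn_disc y hy) (hu.differentiableWithinAt hy)
    (hv.differentiableWithinAt hy)]
  rfl

lemma pd_sub (i : Fin n) (hu : SmoothOnDisc u) (hv : SmoothOnDisc v) (hy : y ∈ disc n) :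
    pd i (fun z => u z - v z) y = pd i u y - pd i v y := by
  simp only [pd]
  rw [fderivWithin_fun_sub (uniqueDiffOn_disc y hy) (hu.differentiableWithinAt hy)
    (hv.differentiableWithinAt hy)]
  rfl

lemma pd_mul (i : Fin n) (hu : SmoothOnDisc u) (hv : SmoothOnDisc v) (hy : y ∈ disc n) :
    pd i (fun z => u z * v z) y = pd i u y * v y + u y * pd i v y := by
  simp only [pd]
  rw [fderivWithin_fun_mul (uniqueDiffOn_disc y hy) (hu.differentiableWithinAt hy)
    (hv.differentiableWithinAt hy)]
  simp
  ring

lemma pd_const_mul (i : Fin n) (c : ℝ) (hu : SmoothOnDisc u) (hy : y ∈ disc n) :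
    pd i (fun z => c * u z) y = c * pd i u y := by
  rw [pd_mul i contDiffOn_const hu hy, pd_const]; ring

lemma pd_neg (i : Fin n) (hu : SmoothOnDisc u) (hy : y ∈ disc n) :
    pd i (fun z => - u z) y = - pd i u y := by
  have := pd_const_mul i (-1) hu hy
  simpa using this

lemma pd_pow (i : Fin n) (m : ℕ) (hu : SmoothOnDisc u) (hy : y ∈ disc n) :
    pd i (fun z => u z ^ m) y = m * u y ^ (m - 1) * pd i u y := by
  simp only [pd]
  rw [fderivWithin_fun_pow (uniqueDiffOn_disc y hy) m (hu.differentiableWithinAt hy)]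
  simp

lemma pd_sum {ι : Type*} (s : Finset ι) {w : ι → EuclideanSpace ℝ (Fin n) → ℝ} (i : Fin n)
    (hw : ∀ a ∈ s, SmoothOnDisc (w a)) (hy : y ∈ disc n) :
    pd i (fun z => ∑ a ∈ s, w a z) y = ∑ a ∈ s, pd i (w a) y := by
  simp only [pd]
  rw [fderivWithin_fun_sum (uniqueDiffOn_disc y hy)
    (fun a ha => (hw a ha).differentiableWithinAt hy)]
  simp

lemma pd_comm (i j : Fin n) (hu : SmoothOnDisc u) (hy : y ∈ disc n) :
    pd i (pd j u) y = pd j (pd i u) y := by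
  have hd : DifferentiableWithinAt ℝ (fderivWithin ℝ u (disc n)) (disc n) y :=
    ((hu.fderivWithin (m := ∞) uniqueDiffOn_disc (by simp)).differentiableOn (by simp)) y hy
  have key : ∀ a b : Fin n, pd a (pd b u) y =
      fderivWithin ℝ (fderivWithin ℝ u (disc n)) (disc n) y (EuclideanSpace.single a 1)
        (EuclideanSpace.single b 1) := by
    intro a b
    have : pd b u = fun z => fderivWithin ℝ u (disc n) z (EuclideanSpace.single b 1) := rfl
    rw [this, pd, fderivWithin_clm_apply (uniqueDiffOn_disc y hy) hd
      (differentiableWithinAt_const _)]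
    simp
  rw [key, key]
  have hs := (hu y hy).isSymmSndFDerivWithinAt (by simpa using two_le_smooth) uniqueDiffOn_disc
    (x := y) (by
      have : y ∈ closure (interior (disc n)) := by
        rw [interior_closedBall _ one_ne_zero, closure_ball _ one_ne_zero]; exact hy
      exact this) hy
  exact hs _ _

end rules

/-- The conformal factor `2 / (1 + |y|²)`, whose square is the standard metric. -/
def lam (y : EuclideanSpace ℝ (Fin n)) : ℝ := 2 / (1 + ‖y‖ ^ 2)

/-- The inverse `(1 + |y|²) / 2` of the conformal factor. -/
def mu (y : EuclideanSpace ℝ (Fin n)) : ℝ := (1 + ‖y‖ ^ 2) / 2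

lemma lam_pos (y : EuclideanSpace ℝ (Fin n)) : 0 < lam y := by unfold lam; positivity

lemma mu_pos (y : EuclideanSpace ℝ (Fin n)) : 0 < mu y := by unfold mu; positivity

lemma lam_mul_mu (y : EuclideanSpace ℝ (Fin n)) : lam y * mu y = 1 := by
  have : 0 < 1 + ‖y‖ ^ 2 := by positivity
  unfold lam mu; field_simp

lemma mu_eq_sum (y : EuclideanSpace ℝ (Fin n)) : mu y = 1 / 2 * (1 + ∑ i, y i * y i) := by
  rw [mu, EuclideanSpace.real_norm_sq_eq]
  simp only [pow_two]; ring

lemma smooth_mu : SmoothOnDisc (mu (n := n)) := by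
  have : mu (n := n) = fun y => (1 + ‖y‖ ^ 2) / 2 := rfl
  rw [this]
  exact ((contDiff_const.add (contDiff_norm_sq ℝ)).div_const 2).contDiffOn

lemma smooth_lam : SmoothOnDisc (lam (n := n)) := by
  have : lam (n := n) = fun y => 2 / (1 + ‖y‖ ^ 2) := rfl
  rw [this]
  exact (contDiff_const.div (contDiff_const.add (contDiff_norm_sq ℝ))
    (fun x => by positivity)).contDiffOn

lemma pd_mu (i : Fin n) {y : EuclideanSpace ℝ (Fin n)} (hy : y ∈ disc n) : pd i mu y = y i := by
  have : mu (n := n) = fun y => 1 / 2 * (1 + ∑ i, y i * y i) := funext mu_eq_sum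
  have hc := fun j : Fin n => smoothOnDisc_coord j
  have hs : ∀ j ∈ Finset.univ, SmoothOnDisc (fun y : EuclideanSpace ℝ (Fin n) => y j * y j) :=
    fun j _ => (hc j).mul (hc j)
  rw [this, pd_const_mul i _ (contDiffOn_const.add (SmoothOnDisc.sum hs)) hy,
    pd_add i contDiffOn_const (SmoothOnDisc.sum hs) hy, pd_sum _ i hs hy]
  simp only [pd_mul i (hc _) (hc _) hy, pd_coord _ _ hy, pd_const]
  simp [Finset.sum_add_distrib]
  ring

lemma pd_lam (i : Fin n) {y : EuclideanSpace ℝ (Fin n)} (hy : y ∈ disc n) :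
    pd i lam y = - (lam y ^ 2 * y i) := by
  have h1 : pd i (fun z => lam z * mu z) y = 0 := by
    simp only [lam_mul_mu]; exact pd_const _ _ _
  rw [pd_mul i smooth_lam smooth_mu hy, pd_mu i hy] at h1
  have := lam_mul_mu y
  linear_combination lam y * h1 - pd i lam y * this

lemma lam_eq_one_of_norm {y : EuclideanSpace ℝ (Fin n)} (hy : ‖y‖ = 1) : lam y = 1 := by
  rw [lam, hy]; norm_num

lemma mu_eq_one_of_norm {y : EuclideanSpace ℝ (Fin n)} (hy : ‖y‖ = 1) : mu y = 1 := by
  rw [mu, hy]; norm_num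

/-- Integration over the unit ball in polar coordinates. -/
lemma integral_disc_polar (hn : 0 < n) {w : EuclideanSpace ℝ (Fin n) → ℝ}
    (hw : ContinuousOn w (disc n)) :
    ∫ y in disc n, w y = ∫ θ : sphere (0 : EuclideanSpace ℝ (Fin n)) 1,
      (∫ r in (0 : ℝ)..1, r ^ (n - 1) * w (r • (θ : EuclideanSpace ℝ (Fin n))))
      ∂(volume : Measure (EuclideanSpace ℝ (Fin n))).toSphere := by
  have : Nonempty (Fin n) := ⟨⟨0, hn⟩⟩
  have hdim : Module.finrank ℝ (EuclideanSpace ℝ (Fin n)) = n := by simp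
  set μ : Measure (EuclideanSpace ℝ (Fin n)) := volume
  have hmp := μ.measurePreserving_homeomorphUnitSphereProd
  rw [hdim] at hmp
  set W : (EuclideanSpace ℝ (Fin n)) → ℝ := (disc n).indicator w with hW
  have hWint : Integrable W μ :=
    (hw.integrableOn_compact (isCompact_closedBall _ _)).integrable_indicator
      measurableSet_closedBall
  let f : sphere (0 : (EuclideanSpace ℝ (Fin n))) 1 × Set.Ioi (0 : ℝ) → ℝ := fun p => W ((p.2 : ℝ) • (p.1 : (EuclideanSpace ℝ (Fin n))))
  have hf : ∀ x : ({(0)}ᶜ : Set (EuclideanSpace ℝ (Fin n))), f (homeomorphUnitSphereProd (EuclideanSpace ℝ (Fin n)) x) = W x := by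
    intro x
    have hx : ‖(x : (EuclideanSpace ℝ (Fin n)))‖ ≠ 0 := norm_ne_zero_iff.mpr x.2
    simp [f, smul_smul, hx]
  have h1 : ∫ y in disc n, w y = ∫ p, f p ∂(μ.toSphere.prod (.volumeIoiPow (n - 1))) := by
    rw [← hmp.integral_comp (Homeomorph.measurableEmbedding _) f]
    simp only [hf]
    rw [integral_subtype_comap (measurableSet_singleton _).compl W,
      restrict_compl_singleton, hW, integral_indicator measurableSet_closedBall]
  have h2 : Integrable f (μ.toSphere.prod (.volumeIoiPow (n - 1))) := by
    rw [← hmp.integrable_comp_emb (Homeomorph.measurableEmbedding _)]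
    have : f ∘ homeomorphUnitSphereProd (EuclideanSpace ℝ (Fin n)) = W ∘ Subtype.val := funext hf
    rw [this, ← integrableOn_iff_comap_subtypeVal (measurableSet_singleton _).compl]
    exact hWint.integrableOn
  rw [h1, integral_prod _ h2]
  refine integral_congr_ae (Filter.Eventually.of_forall fun θ => ?_)
  have hθ : ‖(θ : (EuclideanSpace ℝ (Fin n)))‖ = 1 := by simp
  simp only [f, Measure.volumeIoiPow, ENNReal.ofReal]
  rw [integral_withDensity_eq_integral_smul
      (measurable_subtype_coe.pow_const _).real_toNNReal,
    integral_subtype_comap measurableSet_Ioi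
      fun a : ℝ => Real.toNNReal (a ^ (n - 1)) • W (a • (θ : (EuclideanSpace ℝ (Fin n)))),
    intervalIntegral.integral_of_le zero_le_one]
  rw [← integral_indicator measurableSet_Ioi, ← integral_indicator measurableSet_Ioc]
  congr 1
  ext r
  by_cases h0 : 0 < r
  · have hr : ‖r • (θ : (EuclideanSpace ℝ (Fin n)))‖ = r := by rw [norm_smul, hθ, Real.norm_of_nonneg h0.le, mul_one]
    by_cases hr1 : r ≤ 1
    · have : r • (θ : (EuclideanSpace ℝ (Fin n))) ∈ disc n := by simpa [hr] using hr1
      rw [Set.indicator_of_mem (Set.mem_Ioi.mpr h0), Set.indicator_of_mem (by exact ⟨h0, hr1⟩),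
        hW, Set.indicator_of_mem this, NNReal.smul_def, Real.coe_toNNReal _ (pow_nonneg h0.le _),
        smul_eq_mul]
    · have : r • (θ : (EuclideanSpace ℝ (Fin n))) ∉ disc n := by simpa [hr] using hr1
      rw [Set.indicator_of_mem (Set.mem_Ioi.mpr h0),
        Set.indicator_of_notMem (s := Set.Ioc 0 1) (fun h => hr1 h.2),
        hW, Set.indicator_of_notMem this, smul_zero]
  · rw [Set.indicator_of_notMem (s := Set.Ioi 0) (fun h => h0 h),
      Set.indicator_of_notMem (fun h => h0 h.1)]

lemma fderivWithin_apply_eq_sum (u : EuclideanSpace ℝ (Fin n) → ℝ)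
    (y v : EuclideanSpace ℝ (Fin n)) :
    fderivWithin ℝ u (disc n) y v = ∑ i, v i * pd i u y := by
  conv_lhs => rw [← (EuclideanSpace.basisFun (Fin n) ℝ).sum_repr v]
  simp [pd]

/-- The divergence theorem for radial vector fields on the unit ball. -/
lemma integral_sphere_eq_integral_radial (hn : 0 < n) {v : EuclideanSpace ℝ (Fin n) → ℝ}
    (hv : SmoothOnDisc v) :
    ∫ θ : sphere (0 : EuclideanSpace ℝ (Fin n)) 1, v θ
      ∂(volume : Measure (EuclideanSpace ℝ (Fin n))).toSphere =
    ∫ y in disc n, (n * v y + ∑ i, y i * pd i v y) := by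
  have hs : SmoothOnDisc (fun y => n * v y + ∑ i, y i * pd i v y) :=
    (contDiffOn_const.mul hv).add
      (SmoothOnDisc.sum fun i _ => (smoothOnDisc_coord i).mul (hv.pd i))
  rw [integral_disc_polar hn hs.continuousOn]
  refine integral_congr_ae (Filter.Eventually.of_forall fun θ => ?_)
  have hθ : ‖(θ : EuclideanSpace ℝ (Fin n))‖ = 1 := by simp
  have hmaps : Set.MapsTo (fun r : ℝ => r • (θ : EuclideanSpace ℝ (Fin n))) (Set.Icc 0 1)
      (disc n) := by
    intro r hr
    simpa [norm_smul, hθ, abs_of_nonneg hr.1] using hr.2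
  have hcr : Continuous fun r : ℝ => r • (θ : EuclideanSpace ℝ (Fin n)) := by fun_prop
  have hFTC := intervalIntegral.integral_eq_sub_of_hasDerivAt_of_le (a := (0 : ℝ)) (b := 1)
    zero_le_one (f := fun r => r ^ n * v (r • (θ : EuclideanSpace ℝ (Fin n))))
    (f' := fun r => r ^ (n - 1) * ((fun y => n * v y + ∑ i, y i * pd i v y)
      (r • (θ : EuclideanSpace ℝ (Fin n)))))
    ((continuous_pow n).continuousOn.mul (hv.continuousOn.comp hcr.continuousOn hmaps))
    (by
      intro r hr
      have hmem : r • (θ : EuclideanSpace ℝ (Fin n)) ∈ ball (0 : EuclideanSpace ℝ (Fin n)) 1 := by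
        simpa [norm_smul, hθ, abs_of_pos hr.1] using hr.2
      have hnhds : disc n ∈ nhds (r • (θ : EuclideanSpace ℝ (Fin n))) :=
        Filter.mem_of_superset (isOpen_ball.mem_nhds hmem) ball_subset_closedBall
      have hd : HasFDerivAt v (fderivWithin ℝ v (disc n) (r • (θ : EuclideanSpace ℝ (Fin n))))
          (r • (θ : EuclideanSpace ℝ (Fin n))) :=
        ((hv.differentiableWithinAt (ball_subset_closedBall hmem)).hasFDerivWithinAt).hasFDerivAt
          hnhds
      have hr' : HasDerivAt (fun r : ℝ => r • (θ : EuclideanSpace ℝ (Fin n)))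
          (θ : EuclideanSpace ℝ (Fin n)) r := by
        simpa using (hasDerivAt_id r).smul_const (θ : EuclideanSpace ℝ (Fin n))
      have := (hasDerivAt_pow n r).mul (hd.comp_hasDerivAt r hr')
      refine this.congr_deriv ?_
      rw [fderivWithin_apply_eq_sum]
      obtain ⟨m, rfl⟩ : ∃ m, n = m + 1 := ⟨n - 1, by omega⟩
      simp only [Function.comp, Nat.add_sub_cancel, PiLp.smul_apply, smul_eq_mul]
      have : ∀ i, r * (θ : EuclideanSpace ℝ (Fin (m+1))) i *
          pd i v (r • (θ : EuclideanSpace ℝ (Fin (m+1)))) =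
          r * ((θ : EuclideanSpace ℝ (Fin (m+1))) i *
          pd i v (r • (θ : EuclideanSpace ℝ (Fin (m+1))))) := fun i => by ring
      simp only [this, ← Finset.mul_sum]
      ring)
    (by
      refine ContinuousOn.intervalIntegrable ?_
      rw [Set.uIcc_of_le zero_le_one]
      exact (continuous_pow _).continuousOn.mul
        (hs.continuousOn.comp hcr.continuousOn hmaps))
  refine Eq.trans ?_ hFTC.symm
  simp [hn.ne']

lemma SmoothOnDisc.contDiffAt {u : EuclideanSpace ℝ (Fin n) → ℝ} (hu : SmoothOnDisc u)
    {y : EuclideanSpace ℝ (Fin n)} (hy : ‖y‖ < 1) : ContDiffAt ℝ ∞ u y :=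
  ContDiffOn.contDiffAt hu (Filter.mem_of_superset (isOpen_ball.mem_nhds (by simpa using hy))
    ball_subset_closedBall)

/-- A function that is smooth on the ball and vanishes near its boundary has partial derivatives
of integral zero. -/
lemma integral_pd_eq_zero_of_vanishing {u : EuclideanSpace ℝ (Fin n) → ℝ} (hu : SmoothOnDisc u)
    {ρ : ℝ} (hρ : ρ < 1) (h0 : ∀ y, ρ < ‖y‖ → u y = 0) (i : Fin n) :
    ∫ y in disc n, pd i u y = 0 := by
  have hloc : ∀ y : EuclideanSpace ℝ (Fin n), ρ < ‖y‖ → u =ᶠ[nhds y] fun _ => 0 := fun y hy => by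
    filter_upwards [(isOpen_lt continuous_const continuous_norm).mem_nhds hy] with z hz
    exact h0 z hz
  have hcd : ContDiff ℝ ∞ u := by
    rw [contDiff_iff_contDiffAt]
    intro y
    rcases lt_or_ge ‖y‖ 1 with hy | hy
    · exact hu.contDiffAt hy
    · exact contDiffAt_const.congr_of_eventuallyEq (hloc y (hρ.trans_le hy))
  have hsupp : HasCompactSupport u := by
    refine HasCompactSupport.intro (isCompact_closedBall (0 : EuclideanSpace ℝ (Fin n)) 1) ?_
    intro y hy
    refine h0 y (hρ.trans ?_)
    simpa using hy
  have hint : ∫ y, fderiv ℝ u y (EuclideanSpace.single i 1) = 0 := by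
    have hc : Continuous fun y => fderiv ℝ u y (EuclideanSpace.single i 1) :=
      (hcd.continuous_fderiv (by simp)).clm_apply continuous_const
    have := integral_mul_fderiv_eq_neg_fderiv_mul_of_integrable
      (μ := (volume : Measure (EuclideanSpace ℝ (Fin n)))) (f := fun _ => (1 : ℝ)) (g := u)
      (v := EuclideanSpace.single i 1) (by simp)
      (by simpa using hc.integrable_of_hasCompactSupport (hsupp.fderiv_apply ℝ _))
      (by simpa using hcd.continuous.integrable_of_hasCompactSupport hsupp)
      (fun x _ => differentiableAt_const _)
      (fun x _ => hcd.differentiable (by simp) x)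
    simpa using this
  rw [← hint, ← setIntegral_eq_integral_of_forall_compl_eq_zero (s := disc n)
    (f := fun y => fderiv ℝ u y (EuclideanSpace.single i 1))]
  · refine setIntegral_congr_fun measurableSet_closedBall fun y hy => ?_
    rw [pd, ((hcd.differentiable (by simp) y).hasFDerivAt.hasFDerivWithinAt).fderivWithin
      (uniqueDiffOn_disc y hy)]
  · intro y hy
    have hy1 : ρ < ‖y‖ := hρ.trans (by simpa using hy)
    rw [(hloc y hy1).fderiv_eq]
    simp

/-- The function `1 - |y|²`, which defines the boundary of the ball. -/
def bdf (y : EuclideanSpace ℝ (Fin n)) : ℝ := 1 - ‖y‖ ^ 2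

lemma bdf_eq (y : EuclideanSpace ℝ (Fin n)) : bdf y = 2 - 2 * mu y := by
  rw [bdf, mu]; ring

lemma smooth_bdf : SmoothOnDisc (bdf (n := n)) := by
  rw [show bdf (n := n) = fun y => 2 - 2 * mu y from funext bdf_eq]
  exact contDiffOn_const.sub (contDiffOn_const.mul smooth_mu)

lemma pd_bdf (i : Fin n) {y : EuclideanSpace ℝ (Fin n)} (hy : y ∈ disc n) :
    pd i bdf y = -2 * y i := by
  rw [show bdf (n := n) = fun y => 2 - 2 * mu y from funext bdf_eq,
    pd_sub i contDiffOn_const (contDiffOn_const.mul smooth_mu) hy, pd_const,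
    pd_const_mul i 2 smooth_mu hy, pd_mu i hy]
  ring

lemma pd_comp (i : Fin n) {φ : ℝ → ℝ} (hφ : ContDiff ℝ ∞ φ) {u : EuclideanSpace ℝ (Fin n) → ℝ}
    (hu : SmoothOnDisc u) {y : EuclideanSpace ℝ (Fin n)} (hy : y ∈ disc n) :
    pd i (fun z => φ (u z)) y = deriv φ (u y) * pd i u y := by
  have h1 : HasDerivAt φ (deriv φ (u y)) (u y) := (hφ.differentiable (by simp) _).hasDerivAt
  have h2 := h1.comp_hasFDerivWithinAt y (hu.differentiableWithinAt hy).hasFDerivWithinAt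
  have h3 := h2.fderivWithin (uniqueDiffOn_disc y hy)
  simp only [pd]
  simp only [Function.comp_def] at h3
  rw [h3]
  simp

lemma exists_bound_deriv_smoothTransition :
    ∃ C, ∀ s : ℝ, |s * deriv Real.smoothTransition (s - 1)| ≤ C := by
  have hc : Continuous fun s : ℝ => s * deriv Real.smoothTransition (s - 1) :=
    continuous_id.mul (((Real.smoothTransition.contDiff (n := 1)).continuous_deriv le_rfl).comp
      (continuous_id.sub continuous_const))
  obtain ⟨C, hC⟩ := (isCompact_Icc (a := (1 : ℝ)) (b := 2)).exists_bound_of_continuousOn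
    hc.continuousOn
  have hC0 : 0 ≤ C := (norm_nonneg _).trans (hC 1 (by simp))
  refine ⟨C, fun s => ?_⟩
  by_cases hs : s ∈ Set.Icc (1 : ℝ) 2
  · exact hC s hs
  · have : deriv Real.smoothTransition (s - 1) = 0 := by
      rw [Set.mem_Icc, not_and_or, not_le, not_le] at hs
      rcases hs with hs | hs
      · have : Real.smoothTransition =ᶠ[nhds (s - 1)] fun _ => 0 := by
          filter_upwards [Iio_mem_nhds (show s - 1 < 0 by linarith)] with z hz
          exact Real.smoothTransition.zero_of_nonpos (le_of_lt hz)
        rw [this.deriv_eq]; simp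
      · have : Real.smoothTransition =ᶠ[nhds (s - 1)] fun _ => 1 := by
          filter_upwards [Ioi_mem_nhds (show 1 < s - 1 by linarith)] with z hz
          exact Real.smoothTransition.one_of_one_le (le_of_lt hz)
        rw [this.deriv_eq]; simp
    rw [this]; simpa using hC0

lemma ae_bdf_pos (hn : 0 < n) :
    ∀ᵐ y ∂(volume : Measure (EuclideanSpace ℝ (Fin n))).restrict (disc n), 0 < bdf y := by
  have : Nonempty (Fin n) := ⟨⟨0, hn⟩⟩
  have h1 : ∀ᵐ y ∂(volume : Measure (EuclideanSpace ℝ (Fin n))), y ∉ sphere 0 1 :=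
    measure_eq_zero_iff_ae_notMem.mp (Measure.addHaar_sphere _ _ _)
  filter_upwards [ae_restrict_of_ae h1, ae_restrict_mem measurableSet_closedBall] with y h h'
  have ha : ‖y‖ ≤ 1 := by simpa using h'
  have hb : ‖y‖ ≠ 1 := by simpa using h
  have : ‖y‖ < 1 := lt_of_le_of_ne ha hb
  rw [bdf]; nlinarith [norm_nonneg y]

/-- The divergence theorem for vector fields on the unit ball that are tangent to the boundary. -/
lemma integral_div_eq_zero_of_tangent (hn : 0 < n) {X : Fin n → EuclideanSpace ℝ (Fin n) → ℝ}
    (hX : ∀ j, SmoothOnDisc (X j)) {c : EuclideanSpace ℝ (Fin n) → ℝ} (hc : SmoothOnDisc c)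
    (ht : ∀ y ∈ disc n, ∑ j, y j * X j y = bdf y * c y) :
    ∫ y in disc n, ∑ j, pd j (X j) y = 0 := by
  set χ : ℕ → EuclideanSpace ℝ (Fin n) → ℝ :=
    fun k y => Real.smoothTransition ((k : ℝ) * bdf y - 1) with hχ
  have hsk : ∀ k : ℕ, SmoothOnDisc (fun y : EuclideanSpace ℝ (Fin n) => (k : ℝ) * bdf y - 1) :=
    fun k => (contDiffOn_const.mul smooth_bdf).sub contDiffOn_const
  have hχs : ∀ k, SmoothOnDisc (χ k) := fun k =>
    Real.smoothTransition.contDiff.comp_contDiffOn (hsk k)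
  have hχd : ∀ k j, ∀ y ∈ disc n, pd j (χ k) y =
      deriv Real.smoothTransition (k * bdf y - 1) * (k * (-2 * y j)) := by
    intro k j y hy
    rw [hχ]
    simp only
    rw [pd_comp j Real.smoothTransition.contDiff (hsk k) hy,
      pd_sub j (contDiffOn_const.mul smooth_bdf) contDiffOn_const hy, pd_const,
      pd_const_mul j _ smooth_bdf hy, pd_bdf j hy, sub_zero]
  have hdiv : SmoothOnDisc fun y => ∑ j, pd j (X j) y :=
    SmoothOnDisc.sum fun j _ => (hX j).pd j
  have hzero : ∀ (k : ℕ) (j : Fin n), ∫ y in disc n, pd j (fun z => χ k z * X j z) y = 0 := by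
    intro k j
    refine integral_pd_eq_zero_of_vanishing ((hχs k).mul (hX j)) (ρ := √(1 - 1 / (k + 1))) ?_ ?_ j
    · rw [Real.sqrt_lt' one_pos]
      have : 0 < 1 / ((k : ℝ) + 1) := by positivity
      linarith
    · intro y hy
      have h1 : 1 - 1 / ((k : ℝ) + 1) < ‖y‖ ^ 2 := (Real.sqrt_lt' (by
        exact (Real.sqrt_nonneg _).trans_lt hy)).mp hy
      have : χ k y = 0 := by
        refine Real.smoothTransition.zero_of_nonpos ?_
        have hk : (0 : ℝ) < k + 1 := by positivity
        have h2 : bdf y < 1 / ((k : ℝ) + 1) := by rw [bdf]; linarith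
        have h3 : (k : ℝ) * (1 / ((k : ℝ) + 1)) ≤ 1 := by
          rw [mul_one_div, div_le_one hk]; linarith
        have h4 : (k : ℝ) * bdf y ≤ k * (1 / ((k : ℝ) + 1)) :=
          mul_le_mul_of_nonneg_left h2.le (Nat.cast_nonneg k)
        linarith
      rw [this, zero_mul]
  have hintb : ∀ {v : EuclideanSpace ℝ (Fin n) → ℝ}, SmoothOnDisc v →
      IntegrableOn v (disc n) := fun hv =>
    hv.continuousOn.integrableOn_compact (isCompact_closedBall _ _)
  have hstep : ∀ k : ℕ, ∫ y in disc n, (χ k y * ∑ j, pd j (X j) y -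
      2 * ((k * bdf y) * deriv Real.smoothTransition (k * bdf y - 1)) * c y) = 0 := by
    intro k
    have : ∫ y in disc n, ∑ j, pd j (fun z => χ k z * X j z) y = 0 := by
      rw [integral_finsetSum _ fun j _ => hintb (SmoothOnDisc.pd ((hχs k).mul (hX j)) j)]
      simp [hzero]
    rw [← this]
    refine setIntegral_congr_fun measurableSet_closedBall fun y hy => ?_
    simp only [pd_mul _ (hχs k) (hX _) hy, hχd k _ y hy, Finset.sum_add_distrib, ← Finset.mul_sum]
    have : ∀ j, deriv Real.smoothTransition (k * bdf y - 1) * (k * (-2 * y j)) * X j y =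
      (-2 * k * deriv Real.smoothTransition (k * bdf y - 1)) * (y j * X j y) := fun j => by ring
    simp only [this, ← Finset.mul_sum, ht y hy]
    ring
  obtain ⟨C, hC⟩ := exists_bound_deriv_smoothTransition
  have hlim := tendsto_integral_of_dominated_convergence
    (μ := (volume : Measure (EuclideanSpace ℝ (Fin n))).restrict (disc n))
    (F := fun (k : ℕ) y => χ k y * ∑ j, pd j (X j) y -
      2 * ((k * bdf y) * deriv Real.smoothTransition (k * bdf y - 1)) * c y)
    (f := fun y => ∑ j, pd j (X j) y)
    (fun y => |∑ j, pd j (X j) y| + 2 * C * |c y|)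
    (fun k => by
      refine ContinuousOn.aestronglyMeasurable ?_ measurableSet_closedBall
      refine ((hχs k).continuousOn.mul hdiv.continuousOn).sub
        ((continuousOn_const.mul ?_).mul hc.continuousOn)
      exact (continuousOn_const.mul smooth_bdf.continuousOn).mul
        (((Real.smoothTransition.contDiff (n := 1)).continuous_deriv le_rfl).comp_continuousOn
          (hsk k).continuousOn))
    (((hintb hdiv).abs).add (((hintb hc).abs).const_mul (2 * C)))
    (fun k => Filter.Eventually.of_forall fun y => by
      rw [Real.norm_eq_abs]
      refine (abs_sub _ _).trans (add_le_add ?_ ?_)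
      · rw [abs_mul]
        refine mul_le_of_le_one_left (abs_nonneg _) ?_
        rw [abs_of_nonneg (Real.smoothTransition.nonneg _)]
        exact Real.smoothTransition.le_one _
      · rw [abs_mul, abs_mul, abs_two]
        gcongr
        exact hC _)
    (by
      filter_upwards [ae_bdf_pos hn] with y hy
      refine tendsto_const_nhds.congr' ?_
      have ht : Filter.Tendsto (fun k : ℕ => (k : ℝ) * bdf y) Filter.atTop Filter.atTop :=
        tendsto_natCast_atTop_atTop.atTop_mul_const hy
      filter_upwards [ht.eventually (Filter.eventually_gt_atTop 2)] with k hk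
      have h1 : χ k y = 1 := Real.smoothTransition.one_of_one_le (by linarith)
      have h2 : deriv Real.smoothTransition (k * bdf y - 1) = 0 := by
        have : Real.smoothTransition =ᶠ[nhds (k * bdf y - 1)] fun _ => 1 := by
          filter_upwards [Ioi_mem_nhds (show 1 < k * bdf y - 1 by linarith)] with z hz
          exact Real.smoothTransition.one_of_one_le (le_of_lt hz)
        rw [this.deriv_eq]; simp
      rw [h1, h2]; ring)
  simp only [hstep] at hlim
  exact tendsto_nhds_unique hlim tendsto_const_nhds

/-- The divergence theorem on the unit ball. -/
theorem integral_pd (hn : 0 < n) {u : EuclideanSpace ℝ (Fin n) → ℝ} (hu : SmoothOnDisc u)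
    (i : Fin n) :
    ∫ y in disc n, pd i u y = ∫ y : sphere (0 : EuclideanSpace ℝ (Fin n)) 1,
      u y * (y : EuclideanSpace ℝ (Fin n)) i
      ∂(volume : Measure (EuclideanSpace ℝ (Fin n))).toSphere := by
  have hc := fun j : Fin n => smoothOnDisc_coord (n := n) j
  have hui : SmoothOnDisc fun y => u y * y i := hu.mul (hc i)
  rw [integral_sphere_eq_integral_radial hn hui]
  have hX : ∀ j, SmoothOnDisc fun y : EuclideanSpace ℝ (Fin n) =>
      (if j = i then (1 : ℝ) else 0) * u y - y j * (u y * y i) := fun j =>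
    (contDiffOn_const.mul hu).sub ((hc j).mul hui)
  have h := integral_div_eq_zero_of_tangent hn hX hui (fun y hy => by
    have : ∑ j, y j * y j = ‖y‖ ^ 2 := by
      rw [EuclideanSpace.real_norm_sq_eq]; simp only [pow_two]
    simp only [mul_sub, Finset.sum_sub_distrib, ← mul_assoc, ← Finset.sum_mul, this, bdf]
    simp
    ring)
  have hintb : ∀ {v : EuclideanSpace ℝ (Fin n) → ℝ}, SmoothOnDisc v →
      IntegrableOn v (disc n) := fun hv =>
    hv.continuousOn.integrableOn_compact (isCompact_closedBall _ _)
  rw [← sub_eq_zero, ← integral_sub (hintb (hu.pd i)) (hintb ((contDiffOn_const.mul hui).add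
    (SmoothOnDisc.sum fun j _ => (hc j).mul (hui.pd j)))), ← h]
  refine setIntegral_congr_fun measurableSet_closedBall fun y hy => ?_
  simp only
  simp only [pd_sub _ (contDiffOn_const.mul hu) ((hc _).mul hui) hy, pd_const_mul _ _ hu hy,
    pd_mul _ (hc _) hui hy, pd_coord _ _ hy, Finset.sum_sub_distrib, Finset.sum_add_distrib]
  simp

/-- Smoothness of a one-parameter family of functions near parameter `0` and the point `y`. -/
abbrev SmoothFamilyAt (F : ℝ → EuclideanSpace ℝ (Fin n) → ℝ) (y : EuclideanSpace ℝ (Fin n)) :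
    Prop :=
  ContDiffWithinAt ℝ ∞ (fun p : ℝ × EuclideanSpace ℝ (Fin n) => F p.1 p.2)
    (Set.univ ×ˢ disc n) (0, y)

lemma SmoothOnDisc.smoothFamilyAt {u : EuclideanSpace ℝ (Fin n) → ℝ} (hu : SmoothOnDisc u)
    {y : EuclideanSpace ℝ (Fin n)} (hy : y ∈ disc n) : SmoothFamilyAt (fun _ z => u z) y :=
  (hu y hy).comp (0, y) contDiffWithinAt_snd (fun _ hp => hp.2)

lemma smoothFamilyAt_param (y : EuclideanSpace ℝ (Fin n)) : SmoothFamilyAt (fun t _ => t) y :=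
  contDiffWithinAt_fst

lemma SmoothFamilyAt.differentiableAt {F : ℝ → EuclideanSpace ℝ (Fin n) → ℝ}
    {y : EuclideanSpace ℝ (Fin n)} (hF : SmoothFamilyAt F y) (hy : y ∈ disc n) :
    DifferentiableAt ℝ (fun t => F t y) 0 := by
  have h1 : DifferentiableWithinAt ℝ (fun p : ℝ × EuclideanSpace ℝ (Fin n) => F p.1 p.2)
    (Set.univ ×ˢ disc n) (0, y) := hF.differentiableWithinAt (by simp)
  have h2 : DifferentiableWithinAt ℝ (fun t : ℝ => (t, y)) Set.univ 0 := by fun_prop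
  have := DifferentiableWithinAt.comp (0 : ℝ) h1 h2 (fun t _ =>
    (⟨Set.mem_univ _, hy⟩ : (t, y) ∈ Set.univ ×ˢ disc n))
  exact differentiableWithinAt_univ.mp this

lemma SmoothFamilyAt.congr {F G : ℝ → EuclideanSpace ℝ (Fin n) → ℝ}
    {y : EuclideanSpace ℝ (Fin n)} (hF : SmoothFamilyAt F y) (hy : y ∈ disc n)
    (h : ∀ t, ∀ z ∈ disc n, G t z = F t z) : SmoothFamilyAt G y :=
  ContDiffWithinAt.congr hF (fun p hp => h p.1 p.2 hp.2) (h 0 y hy)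

lemma SmoothFamilyAt.det {m : ℕ} {M : ℝ → EuclideanSpace ℝ (Fin n) → Matrix (Fin m) (Fin m) ℝ}
    {y : EuclideanSpace ℝ (Fin n)} (hM : ∀ i j, SmoothFamilyAt (fun t z => M t z i j) y) :
    SmoothFamilyAt (fun t z => (M t z).det) y := by
  simp only [SmoothFamilyAt, Matrix.det_apply]
  refine ContDiffWithinAt.sum fun σ _ => ContDiffWithinAt.const_smul _ ?_
  exact contDiffWithinAt_prod fun i _ => hM _ _

lemma SmoothFamilyAt.inv {m : ℕ} {M : ℝ → EuclideanSpace ℝ (Fin n) → Matrix (Fin m) (Fin m) ℝ}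
    {y : EuclideanSpace ℝ (Fin n)} (hM : ∀ i j, SmoothFamilyAt (fun t z => M t z i j) y)
    (hdet : (M 0 y).det ≠ 0) (i j : Fin m) : SmoothFamilyAt (fun t z => (M t z)⁻¹ i j) y := by
  have h : ∀ t z, (M t z)⁻¹ i j = ((M t z).det)⁻¹ * (M t z).adjugate i j := fun t z => by
    rw [Matrix.inv_def, Ring.inverse_eq_inv', Matrix.smul_apply, smul_eq_mul]
  simp only [SmoothFamilyAt, h]
  refine (ContDiffWithinAt.inv (SmoothFamilyAt.det hM) hdet).mul ?_
  simp only [Matrix.adjugate_apply]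
  refine SmoothFamilyAt.det (M := fun t z => (M t z).updateRow j (Pi.single i 1)) fun a b => ?_
  by_cases ha : a = j
  · subst ha
    simp only [SmoothFamilyAt, Matrix.updateRow_self]
    exact contDiffWithinAt_const
  · simp only [SmoothFamilyAt, Matrix.updateRow_ne ha]
    exact hM a b

/-- Partial derivatives commute with differentiation in the parameter. -/
lemma SmoothFamilyAt.hasDerivAt_pd {F : ℝ → EuclideanSpace ℝ (Fin n) → ℝ}
    {F' : EuclideanSpace ℝ (Fin n) → ℝ} {y : EuclideanSpace ℝ (Fin n)}
    (hF : SmoothFamilyAt F y) (hy : y ∈ disc n)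
    (hF' : ∀ᶠ z in nhdsWithin y (disc n), HasDerivAt (fun t => F t z) (F' z) 0) (i : Fin n) :
    HasDerivAt (fun t => pd i (F t) y) (pd i F' y) 0 := by
  set Φ : ℝ × EuclideanSpace ℝ (Fin n) → ℝ := fun p => F p.1 p.2 with hΦ
  set s : Set (ℝ × EuclideanSpace ℝ (Fin n)) := Set.univ ×ˢ disc n with hs
  set e : EuclideanSpace ℝ (Fin n) := EuclideanSpace.single i 1
  have hus : UniqueDiffOn ℝ s := uniqueDiffOn_univ.prod uniqueDiffOn_disc
  have hmem : ((0 : ℝ), y) ∈ s := ⟨Set.mem_univ _, hy⟩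
  set A := fderivWithin ℝ Φ s with hA
  have hev : ∀ᶠ p in nhdsWithin ((0 : ℝ), y) s, HasFDerivWithinAt Φ (A p) s p := by
    have h1 : ContDiffWithinAt ℝ 1 Φ s (0, y) := hF.of_le (by simp)
    have h2 := h1.eventually (by simp)
    rw [Set.insert_eq_of_mem hmem] at h2
    filter_upwards [h2] with p hp
    exact (hp.differentiableWithinAt (by simp)).hasFDerivWithinAt
  have hAd : HasFDerivWithinAt A (fderivWithin ℝ A s (0, y)) s (0, y) := by
    have h1 : ContDiffWithinAt ℝ 1 A s (0, y) :=
      (hF.of_le two_le_smooth).fderivWithin_right hus (by norm_num) hmem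
    exact (h1.differentiableWithinAt (by simp)).hasFDerivWithinAt
  have hsymm : IsSymmSndFDerivWithinAt ℝ Φ s (0, y) := by
    refine hF.isSymmSndFDerivWithinAt (by simpa using two_le_smooth) hus ?_ hmem
    rw [interior_prod_eq, closure_prod_eq, interior_univ, closure_univ,
      interior_closedBall _ one_ne_zero, closure_ball _ one_ne_zero]
    exact hmem
  have ht : Filter.Tendsto (fun t : ℝ => (t, y)) (nhds 0) (nhdsWithin ((0 : ℝ), y) s) :=
    tendsto_nhdsWithin_iff.mpr ⟨(Continuous.prodMk_left y).tendsto' _ _ rfl,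
      Filter.Eventually.of_forall fun t => ⟨Set.mem_univ _, hy⟩⟩
  have hz : Filter.Tendsto (fun z => ((0 : ℝ), z)) (nhdsWithin y (disc n))
      (nhdsWithin ((0 : ℝ), y) s) :=
    tendsto_nhdsWithin_iff.mpr ⟨((Continuous.prodMk_right (0 : ℝ)).tendsto' _ _ rfl).mono_left
      nhdsWithin_le_nhds, by
        filter_upwards [self_mem_nhdsWithin] with z hz using ⟨Set.mem_univ _, hz⟩⟩
  have hpd : ∀ᶠ t in nhds (0 : ℝ), pd i (F t) y = A (t, y) (0, e) := by
    filter_upwards [ht.eventually hev] with t htt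
    have h1 : HasFDerivWithinAt (fun z => (t, z))
        (ContinuousLinearMap.inr ℝ ℝ (EuclideanSpace ℝ (Fin n))) (disc n) y :=
      (hasFDerivAt_prodMk_right t y).hasFDerivWithinAt
    have h2 := htt.comp y h1 (fun z hz => ⟨Set.mem_univ _, hz⟩)
    have h3 := h2.fderivWithin (uniqueDiffOn_disc y hy)
    have h4 : Φ ∘ (fun z => (t, z)) = F t := rfl
    rw [h4] at h3
    rw [pd, h3]
    simp [e]
  have hFt : ∀ᶠ z in nhdsWithin y (disc n), F' z = A (0, z) (1, 0) := by
    filter_upwards [hz.eventually hev, hF', self_mem_nhdsWithin] with z h1 h2 hzd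
    have h3 : HasFDerivWithinAt (fun t : ℝ => (t, z))
        (ContinuousLinearMap.inl ℝ ℝ (EuclideanSpace ℝ (Fin n))) Set.univ 0 :=
      (hasFDerivAt_prodMk_left (0 : ℝ) z).hasFDerivWithinAt
    have h4 := h1.comp (0 : ℝ) h3 (fun t _ => (⟨Set.mem_univ _, hzd⟩ : (t, z) ∈ s))
    have h5 := (hasFDerivWithinAt_univ.mp h4).hasDerivAt
    have h6 := h2.unique h5
    simpa using h6
  have hderiv : HasDerivAt (fun t => A (t, y) (0, e))
      (fderivWithin ℝ A s (0, y) (1, 0) (0, e)) 0 := by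
    have h3 : HasFDerivWithinAt (fun t : ℝ => (t, y))
        (ContinuousLinearMap.inl ℝ ℝ (EuclideanSpace ℝ (Fin n))) Set.univ 0 :=
      (hasFDerivAt_prodMk_left (0 : ℝ) y).hasFDerivWithinAt
    have h4 := hAd.comp (0 : ℝ) h3 (fun t _ => (⟨Set.mem_univ _, hy⟩ : (t, y) ∈ s))
    have h5 := (hasFDerivWithinAt_univ.mp h4).hasDerivAt.clm_apply
      (hasDerivAt_const (0 : ℝ) ((0 : ℝ), e))
    refine h5.congr_deriv ?_
    simp
  have hval : pd i F' y = fderivWithin ℝ A s (0, y) (0, e) (1, 0) := by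
    have h3 : HasFDerivWithinAt (fun z => ((0 : ℝ), z))
        (ContinuousLinearMap.inr ℝ ℝ (EuclideanSpace ℝ (Fin n))) (disc n) y :=
      (hasFDerivAt_prodMk_right (0 : ℝ) y).hasFDerivWithinAt
    have h4 := (hAd.comp y h3 (fun z hz => ⟨Set.mem_univ _, hz⟩)).clm_apply
      (hasFDerivWithinAt_const ((1 : ℝ), (0 : EuclideanSpace ℝ (Fin n))) y (disc n))
    have h5 := h4.congr_of_eventuallyEq hFt (hFt.self_of_nhdsWithin hy)
    rw [pd, h5.fderivWithin (uniqueDiffOn_disc y hy)]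
    simp [e]
  rw [hval, hsymm (0, e) (1, 0)]
  exact hderiv.congr_of_eventuallyEq hpd

/-- The metric induced by the inverse stereographic projection is conformally flat. -/
lemma standardMetric_apply {y : EuclideanSpace ℝ (Fin n)} (hy : y ∈ disc n) (i j : Fin n) :
    standardMetric n y i j = if i = j then lam y ^ 2 else 0 := by
  have hc := fun j : Fin n => smoothOnDisc_coord (n := n) j
  have hdiff : Differentiable ℝ (param n) := by
    rw [differentiable_euclidean]
    intro a
    have hnorm : Differentiable ℝ fun z : EuclideanSpace ℝ (Fin n) => ‖z‖ ^ 2 :=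
      (contDiff_norm_sq ℝ (n := 1)).differentiable (by simp)
    have hpos : ∀ z : EuclideanSpace ℝ (Fin n), 1 + ‖z‖ ^ 2 ≠ 0 := fun z => by positivity
    have hden : Differentiable ℝ fun z : EuclideanSpace ℝ (Fin n) => 1 + ‖z‖ ^ 2 :=
      hnorm.const_add 1
    refine Fin.lastCases ?_ (fun k => ?_) a
    · simp only [param_last, div_eq_mul_inv]
      exact Differentiable.fun_mul (hnorm.const_sub 1) (hden.fun_inv hpos)
    · simp only [param_castSucc, div_eq_mul_inv]
      have hk : Differentiable ℝ fun z : EuclideanSpace ℝ (Fin n) => z k :=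
        (EuclideanSpace.proj k : EuclideanSpace ℝ (Fin n) →L[ℝ] ℝ).differentiable
      exact Differentiable.fun_mul (hk.const_mul 2) (hden.fun_inv hpos)
  have hcomp : ∀ (a : Fin (n + 1)) (i : Fin n),
      fderiv ℝ (param n) y (EuclideanSpace.single i 1) a = pd i (fun z => param n z a) y := by
    intro a i
    have h1 := ((EuclideanSpace.proj a : EuclideanSpace ℝ (Fin (n + 1)) →L[ℝ] ℝ).hasFDerivAt.comp
      y (hdiff y).hasFDerivAt).hasFDerivWithinAt (s := disc n)
    have h2 := h1.fderivWithin (uniqueDiffOn_disc y hy)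
    rw [pd]
    erw [h2]
    simp
  have hlast : ∀ i, pd i (fun z => param n z (Fin.last n)) y = - (lam y ^ 2 * y i) := by
    intro i
    have : (fun z => param n z (Fin.last n)) = fun z => lam z - 1 := by
      ext z
      have : 0 < 1 + ‖z‖ ^ 2 := by positivity
      rw [param_last, lam]; field_simp; ring
    rw [this, pd_sub i smooth_lam contDiffOn_const hy, pd_const, pd_lam i hy, sub_zero]
  have hcs : ∀ i k, pd i (fun z => param n z (Fin.castSucc k)) y =
      - (lam y ^ 2 * y i) * y k + lam y * (if i = k then 1 else 0) := by
    intro i k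
    have : (fun z => param n z (Fin.castSucc k)) = fun z => lam z * z k := by
      ext z
      rw [param_castSucc, lam]; ring
    rw [this, pd_mul i smooth_lam (hc k) hy, pd_lam i hy, pd_coord i k hy]
  have hr : lam y * (1 + ‖y‖ ^ 2) = 2 := by
    have : 0 < 1 + ‖y‖ ^ 2 := by positivity
    rw [lam]; field_simp
  have hsum : ∑ k, y k * y k = ‖y‖ ^ 2 := by
    rw [EuclideanSpace.real_norm_sq_eq]; simp only [pow_two]
  simp only [standardMetric, Matrix.of_apply]
  rw [PiLp.inner_apply, Fin.sum_univ_castSucc]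
  simp only [hcomp, hlast, hcs, RCLike.inner_apply, conj_trivial]
  have hk : ∀ k, (-(lam y ^ 2 * y j) * y k + lam y * (if j = k then 1 else 0)) *
      (-(lam y ^ 2 * y i) * y k + lam y * (if i = k then 1 else 0)) =
      lam y ^ 4 * y i * y j * (y k * y k) + (- (lam y ^ 3 * y j * y k)) * (if i = k then 1 else 0)
      + (- (lam y ^ 3 * y i * y k)) * (if j = k then 1 else 0)
      + lam y ^ 2 * ((if i = k then 1 else 0) * (if j = k then 1 else 0)) := fun k => by ring
  simp only [hk, Finset.sum_add_distrib, ← Finset.mul_sum, hsum]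
  simp only [mul_ite, mul_one, mul_zero, Finset.sum_ite_eq, Finset.mem_univ, if_true]
  rw [show (if i = j then lam y ^ 2 else 0) = lam y ^ 2 * (if i = j then 1 else 0) by simp]
  linear_combination (lam y ^ 3 * y i * y j) * hr

/-- The Kronecker delta. -/
def kd (i j : Fin n) : ℝ := if i = j then 1 else 0

lemma kd_self (i : Fin n) : kd i i = 1 := by simp [kd]

lemma kd_comm (i j : Fin n) : kd i j = kd j i := by simp [kd, eq_comm]

lemma sum_mul_kd (f : Fin n → ℝ) (i : Fin n) : ∑ k, f k * kd k i = f i := by simp [kd]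

lemma sum_mul_kd_left (f : Fin n → ℝ) (i : Fin n) : ∑ k, f k * kd i k = f i := by simp [kd]

lemma sum_kd_mul (f : Fin n → ℝ) (i : Fin n) : ∑ k, kd k i * f k = f i := by simp [kd]

lemma sum_kd_mul_left (f : Fin n → ℝ) (i : Fin n) : ∑ k, kd i k * f k = f i := by simp [kd]

lemma sum_kd_self : ∑ k : Fin n, kd k k = n := by simp [kd]

/-- The gradient of the logarithm of the conformal factor. -/
def sg (i : Fin n) (y : EuclideanSpace ℝ (Fin n)) : ℝ := - (lam y * y i)

/-- The Christoffel symbols of the standard metric. -/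
def gam (k i j : Fin n) (y : EuclideanSpace ℝ (Fin n)) : ℝ :=
  sg i y * kd k j + sg j y * kd k i - sg k y * kd i j

/-- The Christoffel symbols of the first kind (doubled) of a tensor field. -/
def cfirst (h : Tensor n) (l i j : Fin n) (y : EuclideanSpace ℝ (Fin n)) : ℝ :=
  pd i (fun z => h z l j) y + pd j (fun z => h z l i) y - pd l (fun z => h z i j) y

/-- The linearization of the Christoffel symbols at the standard metric. -/
def dgam (h : Tensor n) (k i j : Fin n) (y : EuclideanSpace ℝ (Fin n)) : ℝ :=
  mu y ^ 2 * (1 / 2 * cfirst h k i j y - ∑ l, h y k l * gam l i j y)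

lemma smooth_sg (i : Fin n) : SmoothOnDisc (sg (n := n) i) :=
  (smooth_lam.mul (smoothOnDisc_coord i)).neg

lemma smooth_gam (k i j : Fin n) : SmoothOnDisc (gam (n := n) k i j) :=
  (((smooth_sg i).mul contDiffOn_const).add ((smooth_sg j).mul contDiffOn_const)).sub
    ((smooth_sg k).mul contDiffOn_const)

lemma smooth_cfirst {h : Tensor n} (hh : IsSmoothSymm h) (l i j : Fin n) :
    SmoothOnDisc (cfirst h l i j) :=
  ((SmoothOnDisc.pd (hh.1 _ _) i).add (SmoothOnDisc.pd (hh.1 _ _) j)).sub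
    (SmoothOnDisc.pd (hh.1 _ _) l)

lemma smooth_dgam {h : Tensor n} (hh : IsSmoothSymm h) (k i j : Fin n) :
    SmoothOnDisc (dgam h k i j) :=
  (smooth_mu.pow 2).mul ((contDiffOn_const.mul (smooth_cfirst hh k i j)).sub
    (SmoothOnDisc.sum fun l _ => (hh.1 k l).mul (smooth_gam l i j)))

lemma pd_sg (i j : Fin n) {y : EuclideanSpace ℝ (Fin n)} (hy : y ∈ disc n) :
    pd j (sg i) y = sg i y * sg j y - lam y * kd i j := by
  have : sg (n := n) i = fun y => -(lam y * y i) := rfl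
  rw [this, pd_neg j (smooth_lam.mul (smoothOnDisc_coord i)) hy,
    pd_mul j smooth_lam (smoothOnDisc_coord i) hy, pd_lam j hy, pd_coord j i hy, kd_comm]
  simp only [sg, kd]
  ring

lemma standardMetric_eq_kd {y : EuclideanSpace ℝ (Fin n)} (hy : y ∈ disc n) (i j : Fin n) :
    standardMetric n y i j = lam y ^ 2 * kd i j := by
  rw [standardMetric_apply hy, kd]; simp

lemma standardMetric_eq_smul {y : EuclideanSpace ℝ (Fin n)} (hy : y ∈ disc n) :
    standardMetric n y = lam y ^ 2 • (1 : Matrix (Fin n) (Fin n) ℝ) := by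
  ext i j
  rw [standardMetric_eq_kd hy, Matrix.smul_apply, Matrix.one_apply, kd, smul_eq_mul]

lemma standardMetric_det {y : EuclideanSpace ℝ (Fin n)} (hy : y ∈ disc n) :
    (standardMetric n y).det = (lam y ^ n) ^ 2 := by
  rw [standardMetric_eq_smul hy, Matrix.det_smul]
  simp [← pow_mul, mul_comm]

lemma standardMetric_inv {y : EuclideanSpace ℝ (Fin n)} (hy : y ∈ disc n) (i j : Fin n) :
    (standardMetric n y)⁻¹ i j = mu y ^ 2 * kd i j := by
  have h : (standardMetric n y)⁻¹ = mu y ^ 2 • (1 : Matrix (Fin n) (Fin n) ℝ) := by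
    refine Matrix.inv_eq_right_inv ?_
    rw [standardMetric_eq_smul hy, Matrix.smul_mul, Matrix.one_mul, smul_smul, ← mul_pow,
      lam_mul_mu, one_pow, one_smul]
  rw [h, Matrix.smul_apply, Matrix.one_apply, kd, smul_eq_mul]

lemma smooth_standardMetric (i j : Fin n) : SmoothOnDisc fun y => standardMetric n y i j :=
  ((smooth_lam.pow 2).mul contDiffOn_const).congr fun _ hy => standardMetric_eq_kd hy i j

lemma pd_standardMetric (i l j : Fin n) {y : EuclideanSpace ℝ (Fin n)} (hy : y ∈ disc n) :
    pd i (fun z => standardMetric n z l j) y = 2 * lam y ^ 2 * (sg i y * kd l j) := by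
  rw [pd_congr (v := fun z => lam z ^ 2 * kd l j) (fun z hz => standardMetric_eq_kd hz l j) i hy,
    pd_mul i (smooth_lam.pow 2) contDiffOn_const hy, pd_pow i 2 smooth_lam hy, pd_lam i hy,
    pd_const, sg]
  ring

section family

variable {h : Tensor n} {y : EuclideanSpace ℝ (Fin n)}

lemma smoothFamilyAt_metric (hh : IsSmoothSymm h) (hy : y ∈ disc n) (i j : Fin n) :
    SmoothFamilyAt (fun t z => (standardMetric n + t • h) z i j) y :=
  ((smooth_standardMetric i j).smoothFamilyAt hy).add
    ((smoothFamilyAt_param y).mul (SmoothOnDisc.smoothFamilyAt (hh.1 i j) hy))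

lemma smoothFamilyAt_metric_inv (hh : IsSmoothSymm h) (hy : y ∈ disc n) (i j : Fin n) :
    SmoothFamilyAt (fun t z => ((standardMetric n + t • h) z)⁻¹ i j) y :=
  SmoothFamilyAt.inv (M := fun t z => (standardMetric n + t • h) z)
    (smoothFamilyAt_metric hh hy) (by
      have : (standardMetric n + (0 : ℝ) • h) y = standardMetric n y := by simp
      rw [this, standardMetric_det hy]
      have := lam_pos y
      positivity) i j

lemma hasDerivAt_metric (h : Tensor n) (y : EuclideanSpace ℝ (Fin n)) (i j : Fin n) :
    HasDerivAt (fun t : ℝ => (standardMetric n + t • h) y i j) (h y i j) 0 := by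
  simpa using ((hasDerivAt_id (0 : ℝ)).mul_const (h y i j)).const_add (standardMetric n y i j)

lemma hasDerivAt_metric_inv (hh : IsSmoothSymm h) (hy : y ∈ disc n) (i j : Fin n) :
    HasDerivAt (fun t : ℝ => ((standardMetric n + t • h) y)⁻¹ i j) (- (mu y ^ 4 * h y i j)) 0 := by
  have hd : ∀ a b, HasDerivAt (fun t : ℝ => ((standardMetric n + t • h) y)⁻¹ a b)
      (deriv (fun t : ℝ => ((standardMetric n + t • h) y)⁻¹ a b) 0) 0 := fun a b =>
    ((smoothFamilyAt_metric_inv hh hy a b).differentiableAt hy).hasDerivAt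
  set d := fun a b => deriv (fun t : ℝ => ((standardMetric n + t • h) y)⁻¹ a b) 0 with hddef
  have h0 : (standardMetric n + (0 : ℝ) • h) y = standardMetric n y := by simp
  have hdet : ∀ᶠ t in nhds (0 : ℝ), ((standardMetric n + t • h) y).det ≠ 0 := by
    have hc := (SmoothFamilyAt.det (M := fun t z => (standardMetric n + t • h) z)
      (smoothFamilyAt_metric hh hy)).differentiableAt hy
    refine hc.continuousAt.eventually_ne ?_
    rw [h0, standardMetric_det hy]
    have := lam_pos y
    positivity
  have hsum : HasDerivAt (fun t : ℝ => ∑ l, (standardMetric n + t • h) y i l *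
      ((standardMetric n + t • h) y)⁻¹ l j)
      (∑ l, (h y i l * (standardMetric n y)⁻¹ l j + standardMetric n y i l * d l j)) 0 := by
    refine HasDerivAt.fun_sum fun l _ => ?_
    have := (hasDerivAt_metric h y i l).mul (hd l j)
    simp only [h0] at this
    exact this
  have hconst : HasDerivAt (fun t : ℝ => ∑ l, (standardMetric n + t • h) y i l *
      ((standardMetric n + t • h) y)⁻¹ l j) 0 0 := by
    refine (hasDerivAt_const (0 : ℝ) ((1 : Matrix (Fin n) (Fin n) ℝ) i j)).congr_of_eventuallyEq ?_
    filter_upwards [hdet] with t ht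
    rw [← Matrix.mul_apply, Matrix.mul_nonsing_inv _ (isUnit_iff_ne_zero.mpr ht)]
  have key := hsum.unique hconst
  simp only [standardMetric_inv hy, standardMetric_eq_kd hy, Finset.sum_add_distrib] at key
  have e1 : ∑ l, h y i l * (mu y ^ 2 * kd l j) = mu y ^ 2 * h y i j := by
    rw [← sum_mul_kd (fun l => mu y ^ 2 * h y i l) j]
    exact Finset.sum_congr rfl fun l _ => by ring
  have e2 : ∑ l, lam y ^ 2 * kd i l * d l j = lam y ^ 2 * d i j := by
    rw [← sum_kd_mul_left (fun l => lam y ^ 2 * d l j) i]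
    exact Finset.sum_congr rfl fun l _ => by ring
  rw [e1, e2] at key
  have hml := lam_mul_mu y
  have : d i j = - (mu y ^ 4 * h y i j) := by
    have h4 : lam y ^ 2 * mu y ^ 2 = 1 := by rw [← mul_pow, hml, one_pow]
    linear_combination mu y ^ 2 * key - d i j * h4
  rw [← this]
  exact hd i j

lemma christoffel_family (hh : IsSmoothSymm h) (t : ℝ) (hy : y ∈ disc n) (k i j : Fin n) :
    christoffel (standardMetric n + t • h) k i j y =
      1 / 2 * ∑ l, ((standardMetric n + t • h) y)⁻¹ k l *
        (2 * lam y ^ 2 * gam l i j y + t * cfirst h l i j y) := by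
  have hp : ∀ a b c, pd a (fun z => (standardMetric n + t • h) z b c) y =
      2 * lam y ^ 2 * (sg a y * kd b c) + t * pd a (fun z => h z b c) y := by
    intro a b c
    rw [← pd_standardMetric a b c hy, ← pd_const_mul a t (hh.1 b c) hy,
      ← pd_add a (smooth_standardMetric b c) (contDiffOn_const.mul (hh.1 b c)) hy]
    rfl
  rw [christoffel]
  congr 1
  refine Finset.sum_congr rfl fun l _ => ?_
  rw [hp, hp, hp, gam, cfirst]
  ring

lemma christoffel_standardMetric (hy : y ∈ disc n) (k i j : Fin n) :
    christoffel (standardMetric n) k i j y = gam k i j y := by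
  have h := christoffel_family (h := (0 : Tensor n)) (t := 0)
    ⟨fun _ _ => contDiffOn_const, fun _ _ => by simp [Matrix.IsSymm]⟩ hy k i j
  simp only [smul_zero, add_zero, zero_mul, standardMetric_inv hy] at h
  rw [h]
  have : ∀ l, mu y ^ 2 * kd k l * (2 * lam y ^ 2 * gam l i j y) =
      kd k l * (2 * (lam y * mu y) ^ 2 * gam l i j y) := fun l => by ring
  simp only [this, sum_kd_mul_left, lam_mul_mu]
  ring

lemma smoothFamilyAt_christoffel (hh : IsSmoothSymm h) (hy : y ∈ disc n) (k i j : Fin n) :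
    SmoothFamilyAt (fun t => christoffel (standardMetric n + t • h) k i j) y := by
  refine SmoothFamilyAt.congr (F := fun t z => 1 / 2 * ∑ l, ((standardMetric n + t • h) z)⁻¹ k l *
        (2 * lam z ^ 2 * gam l i j z + t * cfirst h l i j z)) ?_ hy
    fun t z hz => christoffel_family hh t hz k i j
  refine contDiffWithinAt_const.mul (ContDiffWithinAt.sum fun l _ => ?_)
  refine (smoothFamilyAt_metric_inv hh hy k l).mul (ContDiffWithinAt.add ?_ ?_)
  · exact SmoothOnDisc.smoothFamilyAt (u := fun z => 2 * lam z ^ 2 * gam l i j z)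
      ((contDiffOn_const.mul (smooth_lam.pow 2)).mul (smooth_gam l i j)) hy
  · exact (smoothFamilyAt_param y).mul ((smooth_cfirst hh l i j).smoothFamilyAt hy)

lemma hasDerivAt_christoffel (hh : IsSmoothSymm h) (hy : y ∈ disc n) (k i j : Fin n) :
    HasDerivAt (fun t : ℝ => christoffel (standardMetric n + t • h) k i j y) (dgam h k i j y) 0 := by
  simp only [christoffel_family hh _ hy]
  have h0 : (standardMetric n + (0 : ℝ) • h) y = standardMetric n y := by simp
  have hs : HasDerivAt (fun t : ℝ => ∑ l, ((standardMetric n + t • h) y)⁻¹ k l *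
        (2 * lam y ^ 2 * gam l i j y + t * cfirst h l i j y))
      (∑ l, (-(mu y ^ 4 * h y k l) * (2 * lam y ^ 2 * gam l i j y) +
        mu y ^ 2 * kd k l * cfirst h l i j y)) 0 := by
    refine HasDerivAt.fun_sum fun l _ => ?_
    have h1 : HasDerivAt (fun t : ℝ => 2 * lam y ^ 2 * gam l i j y + t * cfirst h l i j y)
        (cfirst h l i j y) 0 := by
      simpa using ((hasDerivAt_id (0 : ℝ)).mul_const (cfirst h l i j y)).const_add
        (2 * lam y ^ 2 * gam l i j y)
    have := (hasDerivAt_metric_inv hh hy k l).mul h1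
    simp only [h0, standardMetric_inv hy, zero_mul, add_zero] at this
    exact this
  refine (hs.const_mul (1 / 2)).congr_deriv ?_
  rw [Finset.sum_add_distrib, dgam]
  have e1 : ∑ l, mu y ^ 2 * kd k l * cfirst h l i j y = mu y ^ 2 * cfirst h k i j y := by
    rw [← sum_kd_mul_left (fun l => mu y ^ 2 * cfirst h l i j y) k]
    exact Finset.sum_congr rfl fun l _ => by ring
  have e2 : ∑ l, -(mu y ^ 4 * h y k l) * (2 * lam y ^ 2 * gam l i j y) =
      -2 * mu y ^ 2 * ∑ l, h y k l * gam l i j y := by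
    rw [Finset.mul_sum]
    refine Finset.sum_congr rfl fun l _ => ?_
    linear_combination (-2 * mu y ^ 2 * h y k l * gam l i j y) * (lam y * mu y + 1) * lam_mul_mu y
  rw [e1, e2]
  ring

end family

section contractions

variable (y : EuclideanSpace ℝ (Fin n))

lemma sum_sq (y : EuclideanSpace ℝ (Fin n)) : ∑ k, y k * y k = ‖y‖ ^ 2 := by
  rw [EuclideanSpace.real_norm_sq_eq]; simp only [pow_two]

lemma gam_comm (k i j : Fin n) : gam k i j y = gam k j i y := by
  rw [gam, gam, kd_comm i j]; ring

lemma sum_mul_gam (c : Fin n → ℝ) (i j : Fin n) :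
    ∑ l, c l * gam l i j y = sg i y * c j + sg j y * c i - (∑ l, c l * sg l y) * kd i j := by
  have : ∀ l, c l * gam l i j y = sg i y * (c l * kd l j) + sg j y * (c l * kd l i) -
      (c l * sg l y) * kd i j := fun l => by rw [gam]; ring
  simp only [this, Finset.sum_sub_distrib, Finset.sum_add_distrib, ← Finset.mul_sum,
    ← Finset.sum_mul, sum_mul_kd]

lemma sum_gam_trace (i : Fin n) : ∑ k, gam k i k y = n * sg i y := by
  simp only [gam, Finset.sum_sub_distrib, Finset.sum_add_distrib, ← Finset.mul_sum, sum_kd_self,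
    sum_mul_kd, sum_mul_kd_left]
  ring

lemma sum_gam_diag (l : Fin n) : ∑ i, gam l i i y = (2 - n) * sg l y := by
  simp only [gam, Finset.sum_sub_distrib, Finset.sum_add_distrib, ← Finset.mul_sum, sum_kd_self,
    sum_mul_kd_left]
  ring

lemma sum_gam_mul_sg (k i : Fin n) :
    ∑ l, gam k i l y * sg l y = (∑ l, sg l y * sg l y) * kd k i := by
  have : ∀ l, gam k i l y * sg l y = sg i y * (sg l y * kd k l) + (sg l y * sg l y) * kd k i -
      sg k y * (sg l y * kd i l) := fun l => by rw [gam]; ring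
  simp only [this, Finset.sum_sub_distrib, Finset.sum_add_distrib, ← Finset.mul_sum,
    ← Finset.sum_mul, sum_mul_kd_left]
  ring

lemma sum_sg_sq : ∑ l, sg l y * sg l y = lam y ^ 2 * ‖y‖ ^ 2 := by
  rw [← sum_sq, Finset.mul_sum]
  exact Finset.sum_congr rfl fun l _ => by rw [sg]; ring

end contractions

section curvature

variable {h : Tensor n} {y : EuclideanSpace ℝ (Fin n)}

lemma pd_gam (k i j a : Fin n) (hy : y ∈ disc n) :
    pd a (gam k i j) y = pd a (sg i) y * kd k j + pd a (sg j) y * kd k i -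
      pd a (sg k) y * kd i j := by
  have : gam (n := n) k i j = fun y => sg i y * kd k j + sg j y * kd k i - sg k y * kd i j := rfl
  have hm : ∀ (b : Fin n) (c : ℝ), SmoothOnDisc fun y => sg b y * c := fun b c =>
    (smooth_sg b).mul contDiffOn_const
  have hp : ∀ (b : Fin n) (c : ℝ), pd a (fun y => sg b y * c) y = pd a (sg b) y * c := by
    intro b c
    rw [pd_mul a (smooth_sg b) contDiffOn_const hy, pd_const]; ring
  rw [this, pd_sub a ((hm _ _).add (hm _ _)) (hm _ _) hy, pd_add a (hm _ _) (hm _ _) hy, hp, hp, hp]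

/-- The standard metric is Einstein. -/
lemma ricci_standardMetric (hy : y ∈ disc n) (i j : Fin n) :
    ricci (standardMetric n) i j y = (n - 1) * lam y ^ 2 * kd i j := by
  have hchr := fun (k i j : Fin n) (z : EuclideanSpace ℝ (Fin n)) (hz : z ∈ disc n) =>
    christoffel_standardMetric hz k i j
  have hp : ∀ a k i j, pd a (christoffel (standardMetric n) k i j) y = pd a (gam k i j) y :=
    fun a k i j => pd_congr (hchr k i j) a hy
  rw [ricci]
  simp only [hp, christoffel_standardMetric hy]
  have hA : ∑ k, pd k (gam k i j) y = 2 * pd j (sg i) y - (∑ k, pd k (sg k) y) * kd i j := by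
    have hs : pd i (sg j) y = pd j (sg i) y := by
      rw [pd_sg _ _ hy, pd_sg _ _ hy, kd_comm]; ring
    simp only [pd_gam _ _ _ _ hy, Finset.sum_sub_distrib, Finset.sum_add_distrib,
      ← Finset.sum_mul, sum_mul_kd, hs]
    ring
  have hB : ∑ k, pd j (gam k i k) y = n * pd j (sg i) y := by
    rw [← pd_sum _ j (fun k _ => smooth_gam k i k) hy]
    simp only [sum_gam_trace]
    exact pd_const_mul j _ (smooth_sg i) hy
  have hC : ∑ k, ∑ l, gam k k l y * gam l i j y =
      n * (2 * (sg i y * sg j y) - (∑ l, sg l y * sg l y) * kd i j) := by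
    rw [Finset.sum_comm]
    have : ∀ l, ∑ k, gam k k l y * gam l i j y = n * (sg l y * gam l i j y) := fun l => by
      rw [← Finset.sum_mul]
      simp only [gam_comm y _ _ l, sum_gam_trace]
      ring
    simp only [this, ← Finset.mul_sum, sum_mul_gam]
    ring
  have hD : ∑ k, ∑ l, gam k j l y * gam l i k y =
      (n + 2) * (sg i y * sg j y) - 2 * (∑ l, sg l y * sg l y) * kd i j := by
    simp only [sum_mul_gam y (fun l => gam _ j l y), Finset.sum_sub_distrib,
      Finset.sum_add_distrib, ← Finset.mul_sum, sum_gam_trace, sum_gam_mul_sg]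
    have e1 : ∑ k, (∑ l, sg l y * sg l y) * kd k j * kd i k =
        (∑ l, sg l y * sg l y) * kd i j := by
      rw [← sum_mul_kd_left (fun k => (∑ l, sg l y * sg l y) * kd k j) i]
    rw [e1, sum_mul_gam y (fun k => sg k y), kd_comm j i]
    ring
  have hdiv : ∑ k, pd k (sg k) y = (∑ k, sg k y * sg k y) - n * lam y := by
    simp only [pd_sg _ _ hy, Finset.sum_sub_distrib, ← Finset.mul_sum, sum_kd_self]
    ring
  have hr : lam y * (1 + ‖y‖ ^ 2) = 2 := by
    have : 0 < 1 + ‖y‖ ^ 2 := by positivity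
    rw [lam]; field_simp
  simp only [Finset.sum_sub_distrib]
  rw [hA, hB, hC, hD, hdiv, pd_sg i j hy, sum_sg_sq]
  linear_combination ((1 - (n : ℝ)) * lam y * kd i j) * hr

/-- The linearization of the Ricci tensor at the standard metric. -/
def dricci (h : Tensor n) (i j : Fin n) (y : EuclideanSpace ℝ (Fin n)) : ℝ :=
  ∑ k, (pd k (dgam h k i j) y - pd j (dgam h k i k) y) +
    ∑ k, ∑ l, ((dgam h k k l y * gam l i j y + gam k k l y * dgam h l i j y) -
      (dgam h k j l y * gam l i k y + gam k j l y * dgam h l i k y))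

lemma hasDerivAt_ricci (hh : IsSmoothSymm h) (hy : y ∈ disc n) (i j : Fin n) :
    HasDerivAt (fun t : ℝ => ricci (standardMetric n + t • h) i j y) (dricci h i j y) 0 := by
  have h0 : standardMetric n + (0 : ℝ) • h = standardMetric n := by simp
  have hpd : ∀ a k i j, HasDerivAt
      (fun t : ℝ => pd a (christoffel (standardMetric n + t • h) k i j) y)
      (pd a (dgam h k i j) y) 0 := fun a k i j =>
    (smoothFamilyAt_christoffel hh hy k i j).hasDerivAt_pd hy (by
      filter_upwards [self_mem_nhdsWithin] with z hz
      exact hasDerivAt_christoffel hh hz k i j) a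
  have hprod : ∀ k i j k' i' j', HasDerivAt
      (fun t : ℝ => christoffel (standardMetric n + t • h) k i j y *
        christoffel (standardMetric n + t • h) k' i' j' y)
      (dgam h k i j y * gam k' i' j' y + gam k i j y * dgam h k' i' j' y) 0 := by
    intro k i j k' i' j'
    have := (hasDerivAt_christoffel hh hy k i j).mul (hasDerivAt_christoffel hh hy k' i' j')
    simp only [h0, christoffel_standardMetric hy] at this
    exact this
  unfold ricci dricci
  exact (HasDerivAt.fun_sum fun k _ => (hpd _ _ _ _).fun_sub (hpd _ _ _ _)).fun_add
    (HasDerivAt.fun_sum fun k _ => HasDerivAt.fun_sum fun l _ =>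
      (hprod _ _ _ _ _ _).fun_sub (hprod _ _ _ _ _ _))

lemma linScalar_eq (hh : IsSmoothSymm h) (hy : y ∈ disc n) :
    linScalar (standardMetric n) h y =
      mu y ^ 2 * ∑ i, dricci h i i y - (n - 1) * mu y ^ 2 * ∑ i, h y i i := by
  have h0 : standardMetric n + (0 : ℝ) • h = standardMetric n := by simp
  have hd : HasDerivAt (fun t : ℝ => scalarCurvature (standardMetric n + t • h) y)
      (∑ i, ∑ j, (-(mu y ^ 4 * h y i j) * ((n - 1) * lam y ^ 2 * kd i j) +
        mu y ^ 2 * kd i j * dricci h i j y)) 0 := by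
    unfold scalarCurvature
    refine HasDerivAt.fun_sum fun i _ => HasDerivAt.fun_sum fun j _ => ?_
    have := (hasDerivAt_metric_inv hh hy i j).mul (hasDerivAt_ricci hh hy i j)
    simp only [h0, ricci_standardMetric hy, standardMetric_inv hy] at this
    exact this
  rw [linScalar, hd.deriv]
  have : ∀ i j, -(mu y ^ 4 * h y i j) * ((n - 1) * lam y ^ 2 * kd i j) +
        mu y ^ 2 * kd i j * dricci h i j y =
      kd i j * (mu y ^ 2 * dricci h i j y -
        (n - 1) * mu y ^ 2 * (lam y * mu y) ^ 2 * h y i j) := fun i j => by ring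
  simp only [this, sum_kd_mul_left, lam_mul_mu, Finset.sum_sub_distrib, ← Finset.mul_sum]
  ring

/-- The vector field whose divergence is the leading part of the linearized scalar curvature. -/
def fluxField (h : Tensor n) (k : Fin n) (y : EuclideanSpace ℝ (Fin n)) : ℝ :=
  ∑ i, dgam h k i i y - ∑ j, dgam h j k j y

lemma smooth_fluxField (hh : IsSmoothSymm h) (k : Fin n) : SmoothOnDisc (fluxField h k) :=
  (SmoothOnDisc.sum fun i _ => smooth_dgam hh k i i).sub
    (SmoothOnDisc.sum fun j _ => smooth_dgam hh j k j)

lemma dgam_comm (hh : IsSmoothSymm h) (hy : y ∈ disc n) (k i j : Fin n) :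
    dgam h k i j y = dgam h k j i y := by
  have hs : pd k (fun z => h z i j) y = pd k (fun z => h z j i) y :=
    pd_congr (fun z hz => (hh.2 z hz).apply j i) k hy
  simp only [dgam, cfirst, gam_comm y _ i j, hs]
  ring

lemma sum_dricci (hh : IsSmoothSymm h) (hy : y ∈ disc n) :
    ∑ i, dricci h i i y = ∑ k, (pd k (fluxField h k) y + (n - 2) * sg k y * fluxField h k y) := by
  have hpd : ∀ k, pd k (fluxField h k) y =
      ∑ i, pd k (dgam h k i i) y - ∑ j, pd k (dgam h j k j) y := by
    intro k
    have : fluxField h k = fun y => ∑ i, dgam h k i i y - ∑ j, dgam h j k j y := rfl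
    rw [this, pd_sub k (SmoothOnDisc.sum fun i _ => smooth_dgam hh k i i)
      (SmoothOnDisc.sum fun j _ => smooth_dgam hh j k j) hy,
      pd_sum _ k (fun i _ => smooth_dgam hh k i i) hy,
      pd_sum _ k (fun j _ => smooth_dgam hh j k j) hy]
  have hlead : ∑ i, ∑ k, (pd k (dgam h k i i) y - pd i (dgam h k i k) y) =
      ∑ k, pd k (fluxField h k) y := by
    simp only [hpd, Finset.sum_sub_distrib]
    rw [Finset.sum_comm]
  set a : Fin n → ℝ := fun k => ∑ i, dgam h k i i y with ha
  set b : Fin n → ℝ := fun k => ∑ j, dgam h j k j y with hb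
  have h1 : ∑ i, ∑ k, ∑ l, dgam h k k l y * gam l i i y = (2 - n) * ∑ l, b l * sg l y := by
    have : ∑ i, ∑ k, ∑ l, dgam h k k l y * gam l i i y =
        ∑ l, (∑ k, dgam h k k l y) * ∑ i, gam l i i y := by
      simp only [Finset.sum_mul_sum]
      rw [Finset.sum_comm' (t' := Finset.univ) (s' := fun _ => Finset.univ) (by simp)]
      rw [Finset.sum_congr rfl fun k _ => Finset.sum_comm]
      rw [Finset.sum_comm]
    rw [this, Finset.mul_sum]
    refine Finset.sum_congr rfl fun l _ => ?_
    rw [sum_gam_diag, hb]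
    simp only [dgam_comm hh hy _ l]
    ring
  have h2 : ∑ i, ∑ k, ∑ l, gam k k l y * dgam h l i i y = n * ∑ l, a l * sg l y := by
    have : ∑ i, ∑ k, ∑ l, gam k k l y * dgam h l i i y =
        ∑ l, (∑ k, gam k k l y) * ∑ i, dgam h l i i y := by
      simp only [Finset.sum_mul_sum]
      rw [Finset.sum_comm]
      rw [Finset.sum_congr rfl fun k _ => Finset.sum_comm]
      rw [Finset.sum_comm]
    rw [this, Finset.mul_sum]
    refine Finset.sum_congr rfl fun l _ => ?_
    simp only [gam_comm y _ _ l, sum_gam_trace, ha]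
    ring
  have h3 : ∑ i, ∑ k, ∑ l, dgam h k i l y * gam l i k y = ∑ l, a l * sg l y := by
    simp only [sum_mul_gam y (fun l => dgam h _ _ l y), Finset.sum_sub_distrib,
      Finset.sum_add_distrib]
    have e1 : ∑ i, ∑ k, sg k y * dgam h k i i y = ∑ l, a l * sg l y := by
      rw [Finset.sum_comm]
      refine Finset.sum_congr rfl fun k _ => ?_
      rw [← Finset.mul_sum, ha]; ring
    have e2 : ∑ i, ∑ k, sg i y * dgam h k i k y = ∑ l, b l * sg l y := by
      refine Finset.sum_congr rfl fun k _ => ?_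
      rw [← Finset.mul_sum, hb]; ring
    have e3 : ∑ i, ∑ k, (∑ l, dgam h k i l y * sg l y) * kd i k = ∑ l, b l * sg l y := by
      simp only [sum_mul_kd_left (fun k => ∑ l, dgam h k _ l y * sg l y)]
      rw [Finset.sum_comm]
      refine Finset.sum_congr rfl fun l _ => ?_
      rw [← Finset.sum_mul, hb]
      simp only [dgam_comm hh hy _ l]
    rw [e1, e2, e3]
    ring
  have h4 : ∑ i, ∑ k, ∑ l, gam k i l y * dgam h l i k y = ∑ l, a l * sg l y := by
    rw [← h3]
    refine Finset.sum_congr rfl fun i _ => ?_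
    rw [Finset.sum_comm]
    exact Finset.sum_congr rfl fun k _ => Finset.sum_congr rfl fun l _ => mul_comm _ _
  have hab : ∑ k, (n - 2) * sg k y * fluxField h k y =
      (n - 2) * (∑ l, a l * sg l y - ∑ l, b l * sg l y) := by
    rw [← Finset.sum_sub_distrib, Finset.mul_sum]
    refine Finset.sum_congr rfl fun k _ => ?_
    rw [fluxField]; ring
  unfold dricci
  simp only [Finset.sum_add_distrib, Finset.sum_sub_distrib] at hlead ⊢
  rw [hlead, h1, h2, h3, h4, hab]
  ring

end curvature

/-- The Euclidean trace of a tensor field. -/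
def trh (h : Tensor n) (y : EuclideanSpace ℝ (Fin n)) : ℝ := ∑ i, h y i i

/-- The contraction `h(y, ·)` of a tensor field with the position vector. -/
def hv (h : Tensor n) (j : Fin n) (y : EuclideanSpace ℝ (Fin n)) : ℝ := ∑ l, h y j l * y l

/-- The contraction `h(y, y)` of a tensor field with the position vector. -/
def hvv (h : Tensor n) (y : EuclideanSpace ℝ (Fin n)) : ℝ := ∑ j, y j * hv h j y

section smoothness

variable {h : Tensor n}

lemma smooth_trh (hh : IsSmoothSymm h) : SmoothOnDisc (trh h) :=
  SmoothOnDisc.sum fun i _ => hh.1 i i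

lemma smooth_hv (hh : IsSmoothSymm h) (j : Fin n) : SmoothOnDisc (hv h j) :=
  SmoothOnDisc.sum fun l _ => (hh.1 j l).mul (smoothOnDisc_coord l)

lemma smooth_hvv (hh : IsSmoothSymm h) : SmoothOnDisc (hvv h) :=
  SmoothOnDisc.sum fun j _ => (smoothOnDisc_coord j).mul (smooth_hv hh j)

lemma pd_hv (hh : IsSmoothSymm h) (i j : Fin n) {y : EuclideanSpace ℝ (Fin n)} (hy : y ∈ disc n) :
    pd i (hv h j) y = ∑ l, pd i (fun z => h z j l) y * y l + h y j i := by
  have : hv h j = fun y => ∑ l, h y j l * y l := rfl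
  rw [this, pd_sum _ i (fun l _ => (hh.1 j l).mul (smoothOnDisc_coord l)) hy]
  simp only [pd_mul i (hh.1 j _) (smoothOnDisc_coord _) hy, pd_coord _ _ hy,
    Finset.sum_add_distrib]
  simp

lemma pd_trh (hh : IsSmoothSymm h) (i : Fin n) {y : EuclideanSpace ℝ (Fin n)} (hy : y ∈ disc n) :
    pd i (trh h) y = ∑ j, pd i (fun z => h z j j) y :=
  pd_sum _ i (fun j _ => hh.1 j j) hy

end smoothness

section localrules

variable {u v : EuclideanSpace ℝ (Fin n) → ℝ} {y : EuclideanSpace ℝ (Fin n)}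

lemma pd_mul_of_differentiableWithinAt (i : Fin n) (hu : DifferentiableWithinAt ℝ u (disc n) y)
    (hv : DifferentiableWithinAt ℝ v (disc n) y) (hy : y ∈ disc n) :
    pd i (fun z => u z * v z) y = pd i u y * v y + u y * pd i v y := by
  simp only [pd]
  rw [fderivWithin_fun_mul (uniqueDiffOn_disc y hy) hu hv]
  simp
  ring

lemma pd_add_of_differentiableWithinAt (i : Fin n) (hu : DifferentiableWithinAt ℝ u (disc n) y)
    (hv : DifferentiableWithinAt ℝ v (disc n) y) (hy : y ∈ disc n) :
    pd i (fun z => u z + v z) y = pd i u y + pd i v y := by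
  simp only [pd]
  rw [fderivWithin_fun_add (uniqueDiffOn_disc y hy) hu hv]
  rfl

lemma pd_comp_mu {φ : ℝ → ℝ} {φ' : ℝ} (hφ : HasDerivAt φ φ' (mu y)) (i : Fin n)
    (hy : y ∈ disc n) :
    DifferentiableWithinAt ℝ (fun z => φ (mu z)) (disc n) y ∧
      pd i (fun z => φ (mu z)) y = φ' * y i := by
  have h2 := hφ.comp_hasFDerivWithinAt y
    ((smooth_mu (n := n)).differentiableWithinAt hy).hasFDerivWithinAt
  simp only [Function.comp_def] at h2
  refine ⟨h2.differentiableWithinAt, ?_⟩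
  have h3 := h2.fderivWithin (uniqueDiffOn_disc y hy)
  rw [pd, h3]
  have := pd_mu i hy
  rw [pd] at this
  simp [this]

lemma pd_congr_eventually (huv : u =ᶠ[nhdsWithin y (disc n)] v) (i : Fin n) (hy : y ∈ disc n) :
    pd i u y = pd i v y := by
  rw [pd, pd, huv.fderivWithin_eq (huv.self_of_nhdsWithin hy)]

end localrules

lemma norm_eq_sqrt_mu (z : EuclideanSpace ℝ (Fin n)) : ‖z‖ = √(2 * mu z - 1) := by
  rw [mu, show 2 * ((1 + ‖z‖ ^ 2) / 2) - 1 = ‖z‖ ^ 2 by ring, Real.sqrt_sq (norm_nonneg z)]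

lemma hasDerivAt_sqrt_profile : HasDerivAt (fun m : ℝ => √(2 * m - 1)) 1 1 := by
  have h1 : HasDerivAt (fun m : ℝ => 2 * m - 1) 2 1 := by
    simpa using ((hasDerivAt_id (1 : ℝ)).const_mul 2).sub_const 1
  have := h1.sqrt (by norm_num)
  refine this.congr_deriv ?_
  norm_num

section normal

variable {h : Tensor n} {y : EuclideanSpace ℝ (Fin n)}

lemma normal_standardMetric (hy : y ∈ disc n) (h0 : y ≠ 0) (k : Fin n) :
    normal (standardMetric n) k y = mu y / ‖y‖ * y k := by
  have hp : 0 < ‖y‖ := norm_pos_iff.mpr h0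
  have hm := mu_pos y
  have hN : ∑ l, (standardMetric n y)⁻¹ k l * y l = mu y ^ 2 * y k := by
    simp only [standardMetric_inv hy, mul_assoc, ← Finset.mul_sum, sum_kd_mul_left]
  have hq : ∑ a, ∑ b, (standardMetric n y)⁻¹ a b * y a * y b = (mu y * ‖y‖) ^ 2 := by
    have : ∀ a b, (standardMetric n y)⁻¹ a b * y a * y b = kd a b * (mu y ^ 2 * (y a * y b)) :=
      fun a b => by rw [standardMetric_inv hy]; ring
    simp only [this, sum_kd_mul_left, ← Finset.mul_sum, sum_sq]
    ring
  rw [normal, hN, hq, Real.sqrt_sq (by positivity)]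
  field_simp

/-- The linearization of the unit normal field at the standard metric. -/
def dnormal (h : Tensor n) (k : Fin n) (y : EuclideanSpace ℝ (Fin n)) : ℝ :=
  -(mu y ^ 3 / ‖y‖) * hv h k y + mu y ^ 3 / (2 * ‖y‖ ^ 3) * (y k * hvv h y)

lemma hasDerivAt_normal (hh : IsSmoothSymm h) (hy : y ∈ disc n) (h0 : y ≠ 0) (k : Fin n) :
    HasDerivAt (fun t : ℝ => normal (standardMetric n + t • h) k y) (dnormal h k y) 0 := by
  have hp : 0 < ‖y‖ := norm_pos_iff.mpr h0
  have hm := mu_pos y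
  have hz : standardMetric n + (0 : ℝ) • h = standardMetric n := by simp
  have hN : HasDerivAt (fun t : ℝ => ∑ l, ((standardMetric n + t • h) y)⁻¹ k l * y l)
      (- mu y ^ 4 * hv h k y) 0 := by
    refine (HasDerivAt.fun_sum fun l _ =>
      (hasDerivAt_metric_inv hh hy k l).mul_const (y l)).congr_deriv ?_
    rw [hv, Finset.mul_sum]
    exact Finset.sum_congr rfl fun l _ => by ring
  have hq : HasDerivAt (fun t : ℝ => ∑ a, ∑ b, ((standardMetric n + t • h) y)⁻¹ a b * y a * y b)
      (- mu y ^ 4 * hvv h y) 0 := by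
    refine (HasDerivAt.fun_sum fun a _ => HasDerivAt.fun_sum fun b _ =>
      ((hasDerivAt_metric_inv hh hy a b).mul_const (y a)).mul_const (y b)).congr_deriv ?_
    simp only [hvv, hv, Finset.mul_sum]
    exact Finset.sum_congr rfl fun a _ => Finset.sum_congr rfl fun b _ => by ring
  have hN0 : ∑ l, ((standardMetric n + (0 : ℝ) • h) y)⁻¹ k l * y l = mu y ^ 2 * y k := by
    simp only [hz, standardMetric_inv hy, mul_assoc, ← Finset.mul_sum, sum_kd_mul_left]
  have hq0 : ∑ a, ∑ b, ((standardMetric n + (0 : ℝ) • h) y)⁻¹ a b * y a * y b =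
      (mu y * ‖y‖) ^ 2 := by
    have : ∀ a b, (standardMetric n y)⁻¹ a b * y a * y b = kd a b * (mu y ^ 2 * (y a * y b)) :=
      fun a b => by rw [standardMetric_inv hy]; ring
    simp only [hz, this, sum_kd_mul_left, ← Finset.mul_sum, sum_sq]
    ring
  have hs := hq.sqrt (by rw [hq0]; positivity)
  have := hN.div hs (by rw [hq0, Real.sqrt_sq (by positivity)]; positivity)
  refine this.congr_deriv ?_
  rw [hN0, hq0, Real.sqrt_sq (by positivity), dnormal]
  field_simp
  ring

lemma smoothFamilyAt_normal (hh : IsSmoothSymm h) (hy : y ∈ disc n) (h0 : y ≠ 0) (k : Fin n) :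
    SmoothFamilyAt (fun t => normal (standardMetric n + t • h) k) y := by
  have hp : 0 < ‖y‖ := norm_pos_iff.mpr h0
  have hm := mu_pos y
  have hz : standardMetric n + (0 : ℝ) • h = standardMetric n := by simp
  have hc := fun a : Fin n => (smoothOnDisc_coord a).smoothFamilyAt hy
  have hq0 : ∑ a, ∑ b, ((standardMetric n + (0 : ℝ) • h) y)⁻¹ a b * y a * y b =
      (mu y * ‖y‖) ^ 2 := by
    have : ∀ a b, (standardMetric n y)⁻¹ a b * y a * y b = kd a b * (mu y ^ 2 * (y a * y b)) :=
      fun a b => by rw [standardMetric_inv hy]; ring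
    simp only [hz, this, sum_kd_mul_left, ← Finset.mul_sum, sum_sq]
    ring
  refine ContDiffWithinAt.div (ContDiffWithinAt.sum fun l _ =>
    (smoothFamilyAt_metric_inv hh hy k l).mul (hc l)) (ContDiffWithinAt.sqrt
    (ContDiffWithinAt.sum fun a _ => ContDiffWithinAt.sum fun b _ =>
      ((smoothFamilyAt_metric_inv hh hy a b).mul (hc a)).mul (hc b)) ?_) ?_
  · simp only [hq0]; positivity
  · simp only [hq0, Real.sqrt_sq (mul_nonneg hm.le hp.le)]
    positivity

end normal

section boundary

variable {h : Tensor n} {y : EuclideanSpace ℝ (Fin n)}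

lemma mem_disc_of_norm (hy : ‖y‖ = 1) : y ∈ disc n := by simp [hy]

lemma ne_zero_of_norm (hy : ‖y‖ = 1) : y ≠ 0 := by
  rintro rfl; simp at hy

lemma sg_of_norm (hy : ‖y‖ = 1) (i : Fin n) : sg i y = - y i := by
  rw [sg, lam_eq_one_of_norm hy, one_mul]

lemma eventually_ne_zero (hy : ‖y‖ = 1) : ∀ᶠ z in nhdsWithin y (disc n), z ≠ 0 :=
  nhdsWithin_le_nhds (isOpen_ne.mem_nhds (ne_zero_of_norm hy))

lemma normal_of_norm (hy : ‖y‖ = 1) (k : Fin n) : normal (standardMetric n) k y = y k := by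
  rw [normal_standardMetric (mem_disc_of_norm hy) (ne_zero_of_norm hy), mu_eq_one_of_norm hy, hy]
  ring

lemma pd_normal_of_norm (hy : ‖y‖ = 1) (i k : Fin n) :
    pd i (normal (standardMetric n) k) y = kd i k := by
  have hyd := mem_disc_of_norm hy
  have hev : normal (standardMetric n) k =ᶠ[nhdsWithin y (disc n)]
      fun z => (mu z / √(2 * mu z - 1)) * z k := by
    filter_upwards [eventually_ne_zero hy, self_mem_nhdsWithin] with z hz hzd
    rw [normal_standardMetric hzd hz, ← norm_eq_sqrt_mu]
  have hφ : HasDerivAt (fun m : ℝ => m / √(2 * m - 1)) 0 (mu y) := by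
    rw [mu_eq_one_of_norm hy]
    refine ((hasDerivAt_id (1 : ℝ)).div hasDerivAt_sqrt_profile (by norm_num)).congr_deriv ?_
    norm_num
  obtain ⟨hd, hpd⟩ := pd_comp_mu hφ i hyd
  rw [pd_congr_eventually hev i hyd, pd_mul_of_differentiableWithinAt i hd
    ((smoothOnDisc_coord k).differentiableWithinAt hyd) hyd, hpd, pd_coord i k hyd,
    mu_eq_one_of_norm hy, kd]
  norm_num

lemma pd_dnormal_of_norm (hh : IsSmoothSymm h) (hy : ‖y‖ = 1) (i k : Fin n) :
    pd i (dnormal h k) y = -2 * y i * hv h k y - pd i (hv h k) y +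
      1 / 2 * (kd i k * hvv h y + y k * pd i (hvv h) y) := by
  have hyd := mem_disc_of_norm hy
  have he : dnormal h k = fun z => -(mu z ^ 3 / √(2 * mu z - 1)) * hv h k z +
      mu z ^ 3 / (2 * √(2 * mu z - 1) ^ 3) * (z k * hvv h z) := by
    ext z
    rw [dnormal, norm_eq_sqrt_mu]
  have hα : HasDerivAt (fun m : ℝ => -(m ^ 3 / √(2 * m - 1))) (-2) (mu y) := by
    rw [mu_eq_one_of_norm hy]
    refine ((hasDerivAt_pow 3 (1 : ℝ)).fun_div hasDerivAt_sqrt_profile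
      (by norm_num)).fun_neg.congr_deriv ?_
    norm_num
  have hβ : HasDerivAt (fun m : ℝ => m ^ 3 / (2 * √(2 * m - 1) ^ 3)) 0 (mu y) := by
    rw [mu_eq_one_of_norm hy]
    refine ((hasDerivAt_pow 3 (1 : ℝ)).fun_div ((hasDerivAt_sqrt_profile.fun_pow 3).const_mul 2)
      (by norm_num)).congr_deriv ?_
    norm_num
  obtain ⟨hd1, hp1⟩ := pd_comp_mu hα i hyd
  obtain ⟨hd2, hp2⟩ := pd_comp_mu hβ i hyd
  have hs1 := (smooth_hv hh k).differentiableWithinAt hyd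
  have hsm2 : SmoothOnDisc fun z => z k * hvv h z := (smoothOnDisc_coord k).mul (smooth_hvv hh)
  have hs2 := hsm2.differentiableWithinAt hyd
  rw [he, pd_add_of_differentiableWithinAt i (hd1.fun_mul hs1) (hd2.fun_mul hs2) hyd,
    pd_mul_of_differentiableWithinAt i hd1 hs1 hyd, pd_mul_of_differentiableWithinAt i hd2 hs2 hyd,
    hp1, hp2, pd_mul i (smoothOnDisc_coord k) (smooth_hvv hh) hyd, pd_coord i k hyd,
    mu_eq_one_of_norm hy, kd]
  norm_num
  ring

lemma dnormal_of_norm (hy : ‖y‖ = 1) (k : Fin n) :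
    dnormal h k y = - hv h k y + 1 / 2 * (y k * hvv h y) := by
  rw [dnormal, mu_eq_one_of_norm hy, hy]
  norm_num

/-- The linearization of `∇ν` along the boundary. -/
def dshape (h : Tensor n) (i k : Fin n) (y : EuclideanSpace ℝ (Fin n)) : ℝ :=
  pd i (dnormal h k) y + ∑ l, (dgam h k i l y * y l + gam k i l y * dnormal h l y)

lemma linMean_eq_sum_dshape (hh : IsSmoothSymm h) (hy : ‖y‖ = 1) :
    linMean (standardMetric n) h y = 2 * ∑ i, ∑ j, (kd i j - y i * y j) * dshape h i j y := by
  have hyd := mem_disc_of_norm hy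
  have hy0 := ne_zero_of_norm hy
  have hz : standardMetric n + (0 : ℝ) • h = standardMetric n := by simp
  have hshape0 : ∀ i k, pd i (normal (standardMetric n) k) y +
      ∑ l, christoffel (standardMetric n) k i l y * normal (standardMetric n) l y = 0 := by
    intro i k
    have : ∀ l, christoffel (standardMetric n) k i l y * normal (standardMetric n) l y =
        - (gam k i l y * sg l y) := fun l => by
      rw [christoffel_standardMetric hyd, normal_of_norm hy, sg_of_norm hy]; ring
    simp only [this, pd_normal_of_norm hy, Finset.sum_neg_distrib, sum_gam_mul_sg, sum_sg_sq,
      lam_eq_one_of_norm hy, hy, kd_comm k i]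
    ring
  have hshape : ∀ i k, HasDerivAt (fun t : ℝ => pd i (normal (standardMetric n + t • h) k) y +
      ∑ l, christoffel (standardMetric n + t • h) k i l y *
        normal (standardMetric n + t • h) l y) (dshape h i k y) 0 := by
    intro i k
    refine HasDerivAt.fun_add ?_ (HasDerivAt.fun_sum fun l _ => ?_)
    · refine (smoothFamilyAt_normal hh hyd hy0 k).hasDerivAt_pd hyd ?_ i
      filter_upwards [eventually_ne_zero hy, self_mem_nhdsWithin] with z hz0 hzd
      exact hasDerivAt_normal hh hzd hz0 k
    · have := (hasDerivAt_christoffel hh hyd k i l).mul (hasDerivAt_normal hh hyd hy0 l)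
      simp only [hz, christoffel_standardMetric hyd, normal_of_norm hy] at this
      exact this
  have hsf : ∀ i j, HasDerivAt (fun t : ℝ => secondForm (standardMetric n + t • h) i j y)
      (dshape h i j y) 0 := by
    intro i j
    have : HasDerivAt (fun t : ℝ => secondForm (standardMetric n + t • h) i j y)
        (∑ k, (h y k j * 0 + kd k j * dshape h i k y)) 0 := by
      refine HasDerivAt.fun_sum fun k _ => ?_
      have := (hasDerivAt_metric h y k j).mul (hshape i k)
      simp only [hz, hshape0, standardMetric_eq_kd hyd, lam_eq_one_of_norm hy, one_pow,
        one_mul] at this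
      exact this
    refine this.congr_deriv ?_
    simp only [mul_zero, zero_add, sum_kd_mul]
  have hsf0 : ∀ i j, secondForm (standardMetric n) i j y = 0 := by
    intro i j
    simp only [secondForm, hshape0, mul_zero, Finset.sum_const_zero]
  have hbi : ∀ i j, DifferentiableAt ℝ
      (fun t : ℝ => boundaryInv (standardMetric n + t • h) i j y) 0 := by
    intro i j
    exact ((hasDerivAt_metric_inv hh hyd i j).fun_sub ((hasDerivAt_normal hh hyd hy0 i).fun_mul
      (hasDerivAt_normal hh hyd hy0 j))).differentiableAt
  have hbi0 : ∀ i j, boundaryInv (standardMetric n) i j y = kd i j - y i * y j := by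
    intro i j
    rw [boundaryInv, standardMetric_inv hyd, normal_of_norm hy, normal_of_norm hy,
      mu_eq_one_of_norm hy]
    ring
  have hm : HasDerivAt (fun t : ℝ => meanCurvature (standardMetric n + t • h) y)
      (∑ i, ∑ j, (kd i j - y i * y j) * dshape h i j y) 0 := by
    refine HasDerivAt.fun_sum fun i _ => HasDerivAt.fun_sum fun j _ => ?_
    have := (hbi i j).hasDerivAt.mul (hsf i j)
    simp only [hz, hsf0, hbi0, mul_zero, zero_add] at this
    exact this
  rw [linMean]
  exact (hm.const_mul 2).deriv

end boundary

/-- The contraction `(div h)(y)`. -/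
def divv (h : Tensor n) (y : EuclideanSpace ℝ (Fin n)) : ℝ :=
  ∑ i, ∑ l, pd i (fun z => h z i l) y * y l

/-- The contraction `(∂_y h)(y, y)`. -/
def dvvv (h : Tensor n) (y : EuclideanSpace ℝ (Fin n)) : ℝ :=
  ∑ i, ∑ j, y i * y j * ∑ l, pd i (fun z => h z j l) y * y l

section boundary

variable {h : Tensor n} {y : EuclideanSpace ℝ (Fin n)}

lemma dshape_of_norm (hh : IsSmoothSymm h) (hy : ‖y‖ = 1) (i k : Fin n) :
    dshape h i k y = -2 * y i * hv h k y - pd i (hv h k) y +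
      1 / 2 * (kd i k * hvv h y + y k * pd i (hvv h) y) +
      (1 / 2 * ∑ l, cfirst h k i l y * y l + h y k i) +
      (y i * hv h k y - y k * hv h i y + 1 / 2 * hvv h y * kd i k) := by
  have h1 : ∑ l, dgam h k i l y * y l = 1 / 2 * ∑ l, cfirst h k i l y * y l + h y k i := by
    have e : ∀ l, dgam h k i l y * y l = 1 / 2 * (cfirst h k i l y * y l) +
        ∑ m, h y k m * (gam m i l y * sg l y) := by
      intro l
      rw [dgam, mu_eq_one_of_norm hy, sg_of_norm hy, one_pow, one_mul, sub_mul, Finset.sum_mul,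
        sub_eq_add_neg, ← Finset.sum_neg_distrib]
      congr 1
      · ring
      · exact Finset.sum_congr rfl fun m _ => by ring
    simp only [e, Finset.sum_add_distrib, ← Finset.mul_sum]
    rw [Finset.sum_comm]
    simp only [← Finset.mul_sum, sum_gam_mul_sg, sum_sg_sq, lam_eq_one_of_norm hy, hy]
    simp only [one_pow, one_mul, sum_mul_kd]
  have h2 : ∑ l, gam k i l y * dnormal h l y =
      y i * hv h k y - y k * hv h i y + 1 / 2 * hvv h y * kd i k := by
    have e : ∀ l, gam k i l y * dnormal h l y = sg i y * (kd k l * dnormal h l y) +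
        (sg l y * dnormal h l y) * kd k i - sg k y * (kd i l * dnormal h l y) := fun l => by
      rw [gam]; ring
    have e2 : ∑ l, sg l y * dnormal h l y = 1 / 2 * hvv h y := by
      have : ∀ l, sg l y * dnormal h l y = y l * hv h l y - 1 / 2 * hvv h y * (y l * y l) :=
        fun l => by rw [sg_of_norm hy, dnormal_of_norm hy]; ring
      simp only [this, Finset.sum_sub_distrib, ← Finset.mul_sum, sum_sq, hy]
      rw [← hvv]; ring
    simp only [e, Finset.sum_sub_distrib, Finset.sum_add_distrib, ← Finset.mul_sum,
      ← Finset.sum_mul, sum_kd_mul_left, e2]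
    rw [dnormal_of_norm hy, dnormal_of_norm hy, sg_of_norm hy, sg_of_norm hy, kd_comm k i]
    ring
  rw [dshape, Finset.sum_add_distrib, h1, h2, pd_dnormal_of_norm hh hy, ← add_assoc]

lemma sum_cfirst_trace (hh : IsSmoothSymm h) (hy : y ∈ disc n) :
    ∑ i, ∑ l, cfirst h i i l y * y l = ∑ l, y l * pd l (trh h) y := by
  rw [Finset.sum_comm]
  refine Finset.sum_congr rfl fun l _ => ?_
  rw [pd_trh hh l hy, ← Finset.sum_mul, mul_comm]
  congr 1
  refine Finset.sum_congr rfl fun i _ => ?_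
  rw [cfirst]; ring

lemma sum_cfirst_vvv :
    ∑ i, ∑ j, y i * y j * ∑ l, cfirst h j i l y * y l = dvvv h y := by
  have e : ∀ i j, y i * y j * ∑ l, cfirst h j i l y * y l =
      y i * y j * (∑ l, pd i (fun z => h z j l) y * y l) +
      y i * y j * (∑ l, pd l (fun z => h z j i) y * y l) -
      y i * y j * (∑ l, pd j (fun z => h z i l) y * y l) := by
    intro i j
    rw [← mul_add, ← mul_sub, ← Finset.sum_add_distrib, ← Finset.sum_sub_distrib]
    congr 1
    exact Finset.sum_congr rfl fun l _ => by rw [cfirst]; ring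
  have e2 : ∑ i, ∑ j, y i * y j * (∑ l, pd l (fun z => h z j i) y * y l) = dvvv h y := by
    simp only [dvvv, Finset.mul_sum]
    rw [Finset.sum_comm]
    rw [Finset.sum_congr rfl fun j _ => Finset.sum_comm]
    rw [Finset.sum_comm]
    exact Finset.sum_congr rfl fun l _ => Finset.sum_congr rfl fun j _ =>
      Finset.sum_congr rfl fun i _ => by ring
  have e3 : ∑ i, ∑ j, y i * y j * (∑ l, pd j (fun z => h z i l) y * y l) = dvvv h y := by
    rw [dvvv, Finset.sum_comm]
    exact Finset.sum_congr rfl fun l _ => Finset.sum_congr rfl fun j _ => by ring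
  simp only [e, Finset.sum_sub_distrib, Finset.sum_add_distrib, e2, e3]
  rw [← dvvv]; ring

lemma sum_pd_hv (hh : IsSmoothSymm h) (hy : y ∈ disc n) :
    ∑ i, pd i (hv h i) y = divv h y + trh h y := by
  simp only [pd_hv hh _ _ hy, Finset.sum_add_distrib]
  rfl

lemma sum_mul_pd_hv (hh : IsSmoothSymm h) (hy : y ∈ disc n) :
    ∑ i, ∑ j, y i * y j * pd i (hv h j) y = dvvv h y + hvv h y := by
  simp only [pd_hv hh _ _ hy, mul_add, Finset.sum_add_distrib]
  congr 1
  rw [hvv, Finset.sum_comm]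
  refine Finset.sum_congr rfl fun j _ => ?_
  rw [hv, Finset.mul_sum]
  exact Finset.sum_congr rfl fun i _ => by ring

lemma linMean_eq (hh : IsSmoothSymm h) (hy : ‖y‖ = 1) :
    linMean (standardMetric n) h y = -2 * divv h y + dvvv h y + 2 * (n - 1) * hvv h y +
      ∑ l, y l * pd l (trh h) y := by
  have hyd := mem_disc_of_norm hy
  have hsq : ∑ k, y k * y k = 1 := by rw [sum_sq, hy]; norm_num
  have hvy : ∑ k, y k * hv h k y = hvv h y := rfl
  have htr : ∑ i, dshape h i i y = -2 * hvv h y - (divv h y + trh h y) +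
      1 / 2 * (n * hvv h y + ∑ i, y i * pd i (hvv h) y) +
      (1 / 2 * ∑ l, y l * pd l (trh h) y + trh h y) + 1 / 2 * hvv h y * n := by
    simp only [dshape_of_norm hh hy, Finset.sum_add_distrib, Finset.sum_sub_distrib,
      ← Finset.mul_sum, ← Finset.sum_mul, mul_assoc, sum_kd_self, hvy, sum_pd_hv hh hyd,
      sum_cfirst_trace hh hyd]
    rw [← trh]
    ring
  have hyy : ∑ i, ∑ j, y i * y j * dshape h i j y = -2 * hvv h y - (dvvv h y + hvv h y) +
      1 / 2 * (hvv h y + ∑ i, y i * pd i (hvv h) y) + (1 / 2 * dvvv h y + hvv h y) +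
      1 / 2 * hvv h y := by
    have e : ∀ i j, y i * y j * dshape h i j y =
        (-2 * (y i * y i)) * (y j * hv h j y) - y i * y j * pd i (hv h j) y +
        (1 / 2 * hvv h y * y i) * (y j * kd i j) + (1 / 2 * (y i * pd i (hvv h) y)) * (y j * y j) +
        1 / 2 * (y i * y j * ∑ l, cfirst h j i l y * y l) + y i * y j * h y j i +
        ((y i * y i) * (y j * hv h j y) - (y i * hv h i y) * (y j * y j) +
          (1 / 2 * hvv h y * y i) * (y j * kd i j)) := fun i j => by
      rw [dshape_of_norm hh hy]; ring
    have e1 : ∑ i, ∑ j, y i * y j * h y j i = hvv h y := by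
      rw [hvv, Finset.sum_comm]
      refine Finset.sum_congr rfl fun j _ => ?_
      rw [hv, Finset.mul_sum]
      exact Finset.sum_congr rfl fun i _ => by ring
    simp only [e, Finset.sum_add_distrib, Finset.sum_sub_distrib, e1, ← Finset.mul_sum,
      hvy, hsq, sum_mul_kd_left]
    have e2 : ∑ i, 1 / 2 * hvv h y * y i * y i = 1 / 2 * hvv h y := by
      simp only [mul_assoc, ← Finset.mul_sum, hsq, mul_one]
    simp only [sum_mul_pd_hv hh hyd, sum_cfirst_vvv, e2, ← Finset.sum_mul, ← Finset.mul_sum, hsq,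
      hvy]
    ring
  rw [linMean_eq_sum_dshape hh hy]
  simp only [sub_mul, Finset.sum_sub_distrib, sum_kd_mul_left, htr, hyy]
  ring

end boundary

section bulk

variable {h : Tensor n} {y : EuclideanSpace ℝ (Fin n)}

lemma fluxField_eq (hh : IsSmoothSymm h) (hy : y ∈ disc n) (k : Fin n) :
    fluxField h k y = mu y ^ 2 * (∑ i, pd i (fun z => h z k i) y - pd k (trh h) y +
      (n - 2) * ∑ l, h y k l * sg l y + sg k y * trh h y) := by
  have hsym : ∀ a b, h y a b = h y b a := fun a b => (hh.2 y hy).apply b a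
  have hpsym : ∀ c a b, pd c (fun z => h z a b) y = pd c (fun z => h z b a) y := fun c a b =>
    pd_congr (fun z hz => (hh.2 z hz).apply b a) c hy
  have h1 : ∑ i, dgam h k i i y = mu y ^ 2 * (∑ i, pd i (fun z => h z k i) y -
      1 / 2 * pd k (trh h) y + (n - 2) * ∑ l, h y k l * sg l y) := by
    simp only [dgam, ← Finset.mul_sum, Finset.sum_sub_distrib]
    rw [Finset.sum_comm]
    simp only [← Finset.mul_sum, sum_gam_diag]
    have e1 : ∑ i, cfirst h k i i y = 2 * ∑ i, pd i (fun z => h z k i) y - pd k (trh h) y := by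
      simp only [cfirst, Finset.sum_sub_distrib, Finset.sum_add_distrib, pd_trh hh k hy]
      ring
    have e2 : ∑ l, h y k l * ((2 - n) * sg l y) = (2 - n) * ∑ l, h y k l * sg l y := by
      rw [Finset.mul_sum]
      exact Finset.sum_congr rfl fun l _ => by ring
    rw [e1, e2]
    ring
  have h2 : ∑ j, dgam h j k j y = mu y ^ 2 * (1 / 2 * pd k (trh h) y - sg k y * trh h y) := by
    simp only [dgam, ← Finset.mul_sum, Finset.sum_sub_distrib]
    have e1 : ∑ j, cfirst h j k j y = pd k (trh h) y := by
      rw [pd_trh hh k hy]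
      refine Finset.sum_congr rfl fun j _ => ?_
      rw [cfirst, hpsym j k j]
      ring
    have e2 : ∑ j, ∑ l, h y j l * gam l k j y = sg k y * trh h y := by
      simp only [sum_mul_gam y (fun l => h y _ l), Finset.sum_sub_distrib, Finset.sum_add_distrib,
        ← Finset.mul_sum]
      rw [sum_mul_kd_left (fun j => ∑ l, h y j l * sg l y) k]
      have : ∑ j, sg j y * h y j k = ∑ l, h y k l * sg l y :=
        Finset.sum_congr rfl fun j _ => by rw [hsym j k]; ring
      rw [this, trh]
      ring
    rw [e1, e2]
  rw [fluxField, h1, h2]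
  ring

/-- The weight `(2 / (1 + |y|²)) ^ (n - 4)`. -/
def wt (y : EuclideanSpace ℝ (Fin n)) : ℝ := lam y ^ n * mu y ^ 4

lemma wt_pos (y : EuclideanSpace ℝ (Fin n)) : 0 < wt y :=
  mul_pos (pow_pos (lam_pos y) _) (pow_pos (mu_pos y) _)

lemma wt_of_norm (hy : ‖y‖ = 1) : wt y = 1 := by
  rw [wt, lam_eq_one_of_norm hy, mu_eq_one_of_norm hy]; simp

lemma smooth_lam_pow_mul_mu_pow (a b : ℕ) :
    SmoothOnDisc fun y : EuclideanSpace ℝ (Fin n) => lam y ^ a * mu y ^ b :=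
  (smooth_lam.pow a).mul (smooth_mu.pow b)

lemma smooth_wt : SmoothOnDisc (wt (n := n)) := smooth_lam_pow_mul_mu_pow n 4

lemma pd_lam_pow_mul_mu_pow (a b : ℕ) (i : Fin n) (hy : y ∈ disc n) :
    pd i (fun z => lam z ^ a * mu z ^ b) y = (a - b) * sg i y * (lam y ^ a * mu y ^ b) := by
  have h1 : pd i (fun z => lam z ^ a) y = a * sg i y * lam y ^ a := by
    rw [pd_pow i a smooth_lam hy, pd_lam i hy, sg]
    cases a with
    | zero => simp
    | succ m => simp only [Nat.add_sub_cancel]; ring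
  have h2 : pd i (fun z => mu z ^ b) y = - b * sg i y * mu y ^ b := by
    rw [pd_pow i b smooth_mu hy, pd_mu i hy, sg]
    cases b with
    | zero => simp
    | succ m =>
      simp only [Nat.add_sub_cancel]
      linear_combination (-((m + 1 : ℕ) : ℝ) * y i * mu y ^ m) * lam_mul_mu y
  rw [pd_mul i (smooth_lam.pow a) (smooth_mu.pow b) hy, h1, h2]
  ring

lemma pd_wt (i : Fin n) (hy : y ∈ disc n) : pd i wt y = (n - 4) * sg i y * wt y := by
  have := pd_lam_pow_mul_mu_pow n 4 i hy
  exact_mod_cast this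

/-- The density obtained by moving all derivatives in the linearized scalar curvature from `h`
to the test function `F`. -/
def bulk (F : EuclideanSpace ℝ (Fin n) → ℝ) (h : Tensor n) (y : EuclideanSpace ℝ (Fin n)) : ℝ :=
  ∑ k, ∑ i, h y k i * (pd i (pd k F) y - 2 * sg i y * pd k F y) -
    trh h y * (∑ k, pd k (pd k F) y + (n - 3) * ∑ k, sg k y * pd k F y +
      (n - 1) * lam y ^ 2 * F y)

/-- The field produced by integrating the linearized scalar curvature by parts twice. -/
def bulkField (F : EuclideanSpace ℝ (Fin n) → ℝ) (h : Tensor n) (k : Fin n)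
    (y : EuclideanSpace ℝ (Fin n)) : ℝ :=
  lam y ^ n * mu y ^ 2 * fluxField h k y * F y - ∑ i, wt y * h y i k * pd i F y +
    wt y * trh h y * pd k F y

variable {F : EuclideanSpace ℝ (Fin n) → ℝ}

lemma smooth_bulkField (hF : SmoothOnDisc F) (hh : IsSmoothSymm h) (k : Fin n) :
    SmoothOnDisc (bulkField F h k) :=
  ((((smooth_lam_pow_mul_mu_pow n 2).mul (smooth_fluxField hh k)).mul hF).sub
    (SmoothOnDisc.sum fun i _ => (smooth_wt.mul (hh.1 i k)).mul (hF.pd i))).add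
    ((smooth_wt.mul (smooth_trh hh)).mul (hF.pd k))

lemma smooth_bulk (hF : SmoothOnDisc F) (hh : IsSmoothSymm h) : SmoothOnDisc (bulk F h) := by
  refine ContDiffOn.sub (SmoothOnDisc.sum fun k _ => SmoothOnDisc.sum fun i _ =>
    (hh.1 k i).mul (((hF.pd k).pd i).sub ((contDiffOn_const.mul (smooth_sg i)).mul (hF.pd k))))
    ((smooth_trh hh).mul (((SmoothOnDisc.sum fun k _ => (hF.pd k).pd k).add
    (contDiffOn_const.mul (SmoothOnDisc.sum fun k _ => (smooth_sg k).mul (hF.pd k)))).add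
    ((contDiffOn_const.mul (smooth_lam.pow 2)).mul hF)))

lemma linScalar_mul_eq (hF : SmoothOnDisc F) (hh : IsSmoothSymm h) (hy : y ∈ disc n) :
    linScalar (standardMetric n) h y * F y * lam y ^ n =
      ∑ k, pd k (bulkField F h k) y + wt y * bulk F h y := by
  have hA : ∀ k, pd k (fun z => lam z ^ n * mu z ^ 2 * fluxField h k z * F z) y =
      lam y ^ n * mu y ^ 2 * (pd k (fluxField h k) y + (n - 2) * sg k y * fluxField h k y) * F y +
      wt y * (∑ i, pd i (fun z => h z k i) y - pd k (trh h) y +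
        (n - 2) * ∑ l, h y k l * sg l y + sg k y * trh h y) * pd k F y := by
    intro k
    rw [pd_mul k ((smooth_lam_pow_mul_mu_pow n 2).mul (smooth_fluxField hh k)) hF hy,
      pd_mul k (smooth_lam_pow_mul_mu_pow n 2) (smooth_fluxField hh k) hy,
      pd_lam_pow_mul_mu_pow n 2 k hy, wt]
    have := fluxField_eq hh hy k
    push_cast
    linear_combination (lam y ^ n * mu y ^ 2 * pd k F y) * this
  have hB : ∀ k, pd k (fun z => ∑ i, wt z * h z i k * pd i F z) y =
      ∑ i, wt y * (((n - 4) * sg k y * h y i k + pd k (fun z => h z i k) y) * pd i F y +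
        h y i k * pd k (pd i F) y) := by
    intro k
    rw [pd_sum _ k (fun i _ => (smooth_wt.mul (hh.1 i k)).mul (hF.pd i)) hy]
    refine Finset.sum_congr rfl fun i _ => ?_
    rw [pd_mul k (smooth_wt.mul (hh.1 i k)) (hF.pd i) hy, pd_mul k smooth_wt (hh.1 i k) hy,
      pd_wt k hy]
    ring
  have hC : ∀ k, pd k (fun z => wt z * trh h z * pd k F z) y =
      wt y * (((n - 4) * sg k y * trh h y + pd k (trh h) y) * pd k F y +
        trh h y * pd k (pd k F) y) := by
    intro k
    rw [pd_mul k (smooth_wt.mul (smooth_trh hh)) (hF.pd k) hy, pd_mul k smooth_wt (smooth_trh hh) hy,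
      pd_wt k hy]
    ring
  have hpd : ∀ k, pd k (bulkField F h k) y =
      pd k (fun z => lam z ^ n * mu z ^ 2 * fluxField h k z * F z) y -
      pd k (fun z => ∑ i, wt z * h z i k * pd i F z) y +
      pd k (fun z => wt z * trh h z * pd k F z) y := by
    intro k
    have s1 : SmoothOnDisc fun z => lam z ^ n * mu z ^ 2 * fluxField h k z * F z :=
      ((smooth_lam_pow_mul_mu_pow n 2).mul (smooth_fluxField hh k)).mul hF
    have s2 : SmoothOnDisc fun z => ∑ i, wt z * h z i k * pd i F z :=
      SmoothOnDisc.sum fun i _ => (smooth_wt.mul (hh.1 i k)).mul (hF.pd i)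
    have s3 : SmoothOnDisc fun z => wt z * trh h z * pd k F z :=
      (smooth_wt.mul (smooth_trh hh)).mul (hF.pd k)
    rw [← pd_sub k s1 s2 hy, ← pd_add k (s1.sub s2) s3 hy]
    rfl
  have hswap : ∑ k, ∑ i, wt y * (((n - 4) * sg k y * h y i k +
        pd k (fun z => h z i k) y) * pd i F y + h y i k * pd k (pd i F) y) =
      ∑ k, ∑ i, wt y * (((n - 4) * sg i y * h y k i +
        pd i (fun z => h z k i) y) * pd k F y + h y k i * pd i (pd k F) y) := by
    rw [Finset.sum_comm]
  have hR : lam y ^ n * mu y ^ 2 * (∑ i, dricci h i i y) * F y = ∑ k, lam y ^ n * mu y ^ 2 *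
      (pd k (fluxField h k) y + (n - 2) * sg k y * fluxField h k y) * F y := by
    rw [sum_dricci hh hy, Finset.mul_sum, Finset.sum_mul]
  simp only [hpd, hA, hB, hC, Finset.sum_sub_distrib, Finset.sum_add_distrib]
  rw [← Finset.sum_add_distrib, hswap]
  have hbulk : wt y * bulk F h y = ∑ k, (∑ i, wt y * (h y k i * (pd i (pd k F) y -
      2 * sg i y * pd k F y)) - wt y * trh h y * (pd k (pd k F) y + (n - 3) * (sg k y * pd k F y)))
      - (n - 1) * (wt y * lam y ^ 2) * trh h y * F y := by
    rw [bulk]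
    simp only [Finset.sum_sub_distrib, ← Finset.mul_sum, Finset.sum_add_distrib]
    ring
  have hw : wt y * lam y ^ 2 = lam y ^ n * mu y ^ 2 := by
    rw [wt]
    linear_combination (lam y ^ n * mu y ^ 2) * (lam y * mu y + 1) * lam_mul_mu y
  have hT : trh h y = ∑ i, h y i i := rfl
  rw [linScalar_eq hh hy, ← hT, hbulk, hw]
  have hmain : ∑ k, wt y * (∑ i, pd i (fun z => h z k i) y - pd k (trh h) y +
        (n - 2) * ∑ l, h y k l * sg l y + sg k y * trh h y) * pd k F y
      - ∑ k, ∑ i, wt y * (((n - 4) * sg i y * h y k i +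
        pd i (fun z => h z k i) y) * pd k F y + h y k i * pd i (pd k F) y)
      + ∑ k, wt y * (((n - 4) * sg k y * trh h y + pd k (trh h) y) * pd k F y +
        trh h y * pd k (pd k F) y)
      + ∑ k, (∑ i, wt y * (h y k i * (pd i (pd k F) y -
      2 * sg i y * pd k F y)) - wt y * trh h y * (pd k (pd k F) y + (n - 3) * (sg k y * pd k F y)))
      = 0 := by
    rw [← Finset.sum_sub_distrib, ← Finset.sum_add_distrib, ← Finset.sum_add_distrib]
    refine Finset.sum_eq_zero fun k _ => ?_
    have : ∀ i, wt y * (((n - 4) * sg i y * h y k i + pd i (fun z => h z k i) y) * pd k F y +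
        h y k i * pd i (pd k F) y) = wt y * (n - 4) * pd k F y * (h y k i * sg i y) +
        wt y * pd k F y * pd i (fun z => h z k i) y + wt y * (h y k i * pd i (pd k F) y) :=
      fun i => by ring
    have h2 : ∀ i, wt y * (h y k i * (pd i (pd k F) y - 2 * sg i y * pd k F y)) =
        wt y * (h y k i * pd i (pd k F) y) - wt y * 2 * pd k F y * (h y k i * sg i y) :=
      fun i => by ring
    simp only [this, h2, Finset.sum_add_distrib, Finset.sum_sub_distrib, ← Finset.mul_sum]
    ring
  simp only [Finset.sum_add_distrib, Finset.sum_sub_distrib] at hmain hR ⊢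
  linear_combination hR - hmain

end bulk

lemma mem_disc_of_sphere (y : sphere (0 : EuclideanSpace ℝ (Fin n)) 1) :
    (y : EuclideanSpace ℝ (Fin n)) ∈ disc n := sphere_subset_closedBall y.2

lemma norm_of_sphere (y : sphere (0 : EuclideanSpace ℝ (Fin n)) 1) :
    ‖(y : EuclideanSpace ℝ (Fin n))‖ = 1 := by simp

lemma SmoothOnDisc.integrableOn {u : EuclideanSpace ℝ (Fin n) → ℝ} (hu : SmoothOnDisc u) :
    IntegrableOn u (disc n) :=
  hu.continuousOn.integrableOn_compact (isCompact_closedBall _ _)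

lemma SmoothOnDisc.integrable_sphere {u : EuclideanSpace ℝ (Fin n) → ℝ} (hu : SmoothOnDisc u) :
    Integrable (fun y : sphere (0 : EuclideanSpace ℝ (Fin n)) 1 => u y)
      (volume : Measure (EuclideanSpace ℝ (Fin n))).toSphere := by
  have hc : Continuous fun y : sphere (0 : EuclideanSpace ℝ (Fin n)) 1 => u y :=
    hu.continuousOn.comp_continuous continuous_subtype_val mem_disc_of_sphere
  exact hc.integrable_of_hasCompactSupport (HasCompactSupport.of_compactSpace _)

/-- The divergence theorem for a vector field with smooth components. -/
lemma integral_div (hn : 0 < n) {Z : Fin n → EuclideanSpace ℝ (Fin n) → ℝ}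
    (hZ : ∀ k, SmoothOnDisc (Z k)) :
    ∫ y in disc n, ∑ k, pd k (Z k) y = ∫ y : sphere (0 : EuclideanSpace ℝ (Fin n)) 1,
      ∑ k, Z k y * (y : EuclideanSpace ℝ (Fin n)) k
      ∂(volume : Measure (EuclideanSpace ℝ (Fin n))).toSphere := by
  rw [integral_finsetSum _ fun k _ => ((hZ k).pd k).integrableOn,
    integral_finsetSum _ fun k _ =>
      SmoothOnDisc.integrable_sphere ((hZ k).mul (smoothOnDisc_coord k))]
  exact Finset.sum_congr rfl fun k _ => integral_pd hn (hZ k) k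

/-- Rotation fields are divergence free on the sphere. -/
lemma integral_sphere_rotation (hn : 0 < n) {u : EuclideanSpace ℝ (Fin n) → ℝ}
    (hu : SmoothOnDisc u) (k l : Fin n) :
    ∫ y : sphere (0 : EuclideanSpace ℝ (Fin n)) 1,
      (pd k u y * (y : EuclideanSpace ℝ (Fin n)) l - pd l u y * (y : EuclideanSpace ℝ (Fin n)) k)
      ∂(volume : Measure (EuclideanSpace ℝ (Fin n))).toSphere = 0 := by
  rw [integral_sub (SmoothOnDisc.integrable_sphere ((hu.pd k).mul (smoothOnDisc_coord l)))
    (SmoothOnDisc.integrable_sphere ((hu.pd l).mul (smoothOnDisc_coord k))),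
    ← integral_pd hn (hu.pd k) l, ← integral_pd hn (hu.pd l) k, sub_eq_zero]
  exact setIntegral_congr_fun measurableSet_closedBall fun y hy => pd_comm l k hu hy

/-- The divergence theorem on the unit sphere, for the tangential part of a vector field. -/
lemma integral_sphere_div (hn : 0 < n) {U : Fin n → EuclideanSpace ℝ (Fin n) → ℝ}
    (hU : ∀ k, SmoothOnDisc (U k)) :
    ∫ y : sphere (0 : EuclideanSpace ℝ (Fin n)) 1,
      (∑ k, pd k (U k) y - ∑ l, ∑ k, (y : EuclideanSpace ℝ (Fin n)) l *
        (y : EuclideanSpace ℝ (Fin n)) k * pd l (U k) y -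
        (n - 1) * ∑ k, (y : EuclideanSpace ℝ (Fin n)) k * U k y)
      ∂(volume : Measure (EuclideanSpace ℝ (Fin n))).toSphere = 0 := by
  have hs : ∀ l k, SmoothOnDisc fun y : EuclideanSpace ℝ (Fin n) => y l * U k y := fun l k =>
    (smoothOnDisc_coord l).mul (hU k)
  have h : ∫ y : sphere (0 : EuclideanSpace ℝ (Fin n)) 1, ∑ l, ∑ k,
      (pd k (fun z => z l * U k z) y * (y : EuclideanSpace ℝ (Fin n)) l -
        pd l (fun z => z l * U k z) y * (y : EuclideanSpace ℝ (Fin n)) k)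
      ∂(volume : Measure (EuclideanSpace ℝ (Fin n))).toSphere = 0 := by
    have hint : ∀ l k, Integrable (fun y : sphere (0 : EuclideanSpace ℝ (Fin n)) 1 =>
      (pd k (fun z => z l * U k z) y * (y : EuclideanSpace ℝ (Fin n)) l -
        pd l (fun z => z l * U k z) y * (y : EuclideanSpace ℝ (Fin n)) k))
      (volume : Measure (EuclideanSpace ℝ (Fin n))).toSphere := fun l k =>
      (SmoothOnDisc.integrable_sphere (((hs l k).pd k).mul (smoothOnDisc_coord l))).sub
        (SmoothOnDisc.integrable_sphere (((hs l k).pd l).mul (smoothOnDisc_coord k)))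
    rw [integral_finsetSum _ fun l _ => integrable_finsetSum _ fun k _ => hint l k]
    refine Finset.sum_eq_zero fun l _ => ?_
    rw [integral_finsetSum _ fun k _ => hint l k]
    exact Finset.sum_eq_zero fun k _ => integral_sphere_rotation hn (hs l k) k l
  rw [← h]
  refine integral_congr_ae (Filter.Eventually.of_forall fun y => ?_)
  have hyd := mem_disc_of_sphere y
  have hsq : ∑ k, (y : EuclideanSpace ℝ (Fin n)) k * (y : EuclideanSpace ℝ (Fin n)) k = 1 := by
    rw [sum_sq, norm_of_sphere]; norm_num
  beta_reduce
  generalize (y : EuclideanSpace ℝ (Fin n)) = x at hyd hsq ⊢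
  have e : ∀ l k, pd k (fun z => z l * U k z) x * x l - pd l (fun z => z l * U k z) x * x k =
      (x l * U k x) * kd k l + (x l * x l) * pd k (U k) x - x k * U k x -
        x l * x k * pd l (U k) x := by
    intro l k
    rw [pd_mul k (smoothOnDisc_coord l) (hU k) hyd, pd_mul l (smoothOnDisc_coord l) (hU k) hyd,
      pd_coord k l hyd, pd_coord l l hyd, ← kd]
    simp only [if_true]
    ring
  simp only [e, Finset.sum_sub_distrib, Finset.sum_add_distrib, sum_mul_kd, ← Finset.mul_sum,
    ← Finset.sum_mul, hsq, Finset.sum_const, Finset.card_univ, Fintype.card_fin, nsmul_eq_mul]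
  ring

section pairing

variable {h : Tensor n} {F : EuclideanSpace ℝ (Fin n) → ℝ}

lemma linMean_add_flux (hh : IsSmoothSymm h) {y : EuclideanSpace ℝ (Fin n)} (hy : ‖y‖ = 1) :
    linMean (standardMetric n) h y + ∑ k, fluxField h k y * y k =
      - (divv h y + trh h y - dvvv h y - n * hvv h y) := by
  have hyd := mem_disc_of_norm hy
  have hsq : ∑ k, y k * y k = 1 := by rw [sum_sq, hy]; norm_num
  have hpsym : ∀ c a b, pd c (fun z => h z a b) y = pd c (fun z => h z b a) y := fun c a b =>
    pd_congr (fun z hz => (hh.2 z hz).apply b a) c hyd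
  have e : ∀ k, fluxField h k y * y k = ∑ i, pd i (fun z => h z i k) y * y k -
      y k * pd k (trh h) y - (n - 2) * (y k * hv h k y) - trh h y * (y k * y k) := by
    intro k
    have h1 : ∑ l, h y k l * sg l y = - hv h k y := by
      rw [hv, ← Finset.sum_neg_distrib]
      exact Finset.sum_congr rfl fun l _ => by rw [sg_of_norm hy]; ring
    rw [fluxField_eq hh hyd, mu_eq_one_of_norm hy, h1, sg_of_norm hy, ← Finset.sum_mul]
    simp only [hpsym _ k]
    ring
  have h2 : ∑ k, ∑ i, pd i (fun z => h z i k) y * y k = divv h y := by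
    rw [divv, Finset.sum_comm]
  have h3 : ∑ k, y k * hv h k y = hvv h y := rfl
  simp only [e, Finset.sum_sub_distrib, ← Finset.mul_sum, hsq, h2, h3]
  rw [linMean_eq hh hy]
  ring

/-- The pairing that defines the formal adjoint, after integration by parts. -/
theorem integral_pairing (hn : 0 < n) (hF : SmoothOnDisc F) (hh : IsSmoothSymm h) :
    integralM (standardMetric n) (fun y => linScalar (standardMetric n) h y * F y) +
      integralBoundary (standardMetric n) (fun y => linMean (standardMetric n) h y * F y) =
    (∫ y in disc n, wt y * bulk F h y) +
      ∫ y : sphere (0 : EuclideanSpace ℝ (Fin n)) 1,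
        (trh h y - hvv h y) * ∑ i, (y : EuclideanSpace ℝ (Fin n)) i * pd i F y
        ∂(volume : Measure (EuclideanSpace ℝ (Fin n))).toSphere := by
  have hM : integralM (standardMetric n) (fun y => linScalar (standardMetric n) h y * F y) =
      ∫ y in disc n, (∑ k, pd k (bulkField F h k) y + wt y * bulk F h y) := by
    refine setIntegral_congr_fun measurableSet_closedBall fun y hy => ?_
    simp only
    rw [standardMetric_det hy, Real.sqrt_sq (pow_nonneg (lam_pos y).le _),
      linScalar_mul_eq hF hh hy]
  have hdivU := integral_sphere_div hn (U := fun k y => F y * hv h k y)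
    (fun k => hF.mul (smooth_hv hh k))
  rw [hM, integral_add (SmoothOnDisc.integrableOn
      (SmoothOnDisc.sum fun k _ => (smooth_bulkField hF hh k).pd k))
      (SmoothOnDisc.integrableOn (smooth_wt.mul (smooth_bulk hF hh))),
    integral_div hn (smooth_bulkField hF hh), add_right_comm, add_comm]
  congr 1
  have hpt : ∀ y : sphere (0 : EuclideanSpace ℝ (Fin n)) 1,
      linMean (standardMetric n) h y * F y * (√(standardMetric n y).det *
        ∑ l, normal (standardMetric n) l y * (y : EuclideanSpace ℝ (Fin n)) l) =
      (trh h y - hvv h y) * ∑ i, (y : EuclideanSpace ℝ (Fin n)) i * pd i F y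
      - ∑ k, bulkField F h k y * (y : EuclideanSpace ℝ (Fin n)) k
      - (∑ k, pd k (fun z => F z * hv h k z) y - ∑ l, ∑ k, (y : EuclideanSpace ℝ (Fin n)) l *
        (y : EuclideanSpace ℝ (Fin n)) k * pd l (fun z => F z * hv h k z) y -
        (n - 1) * ∑ k, (y : EuclideanSpace ℝ (Fin n)) k * (F y * hv h k y)) := by
    intro y
    have hyd := mem_disc_of_sphere y
    have hy := norm_of_sphere y
    generalize (y : EuclideanSpace ℝ (Fin n)) = x at hyd hy ⊢
    have hsq : ∑ k, x k * x k = 1 := by rw [sum_sq, hy]; norm_num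
    have hsym : ∀ a b, h x a b = h x b a := fun a b => (hh.2 x hyd).apply b a
    have hvx : ∑ k, x k * hv h k x = hvv h x := rfl
    rw [standardMetric_det hyd, Real.sqrt_sq (pow_nonneg (lam_pos x).le _), lam_eq_one_of_norm hy]
    simp only [normal_of_norm hy, hsq]
    have hb : ∑ k, bulkField F h k x * x k = (∑ k, fluxField h k x * x k) * F x -
        ∑ i, pd i F x * hv h i x + trh h x * ∑ i, x i * pd i F x := by
      have e : ∀ k, bulkField F h k x * x k = (fluxField h k x * x k) * F x -
          ∑ i, pd i F x * (h x i k * x k) + trh h x * (x k * pd k F x) := by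
        intro k
        rw [bulkField, lam_eq_one_of_norm hy, mu_eq_one_of_norm hy, wt_of_norm hy, add_mul, sub_mul,
          Finset.sum_mul]
        congr 1
        · congr 1
          · ring
          · exact Finset.sum_congr rfl fun i _ => by ring
        · ring
      simp only [e, Finset.sum_add_distrib, Finset.sum_sub_distrib, ← Finset.mul_sum,
        ← Finset.sum_mul]
      rw [Finset.sum_comm]
      simp only [← Finset.mul_sum, hv]
    have hp : ∀ l k, pd l (fun z => F z * hv h k z) x =
        pd l F x * hv h k x + F x * pd l (hv h k) x := fun l k =>
      pd_mul l hF (smooth_hv hh k) hyd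
    have h1 : ∑ k, pd k (fun z => F z * hv h k z) x =
        ∑ i, pd i F x * hv h i x + F x * (divv h x + trh h x) := by
      simp only [hp, Finset.sum_add_distrib, ← Finset.mul_sum, sum_pd_hv hh hyd]
    have h2 : ∑ l, ∑ k, x l * x k * pd l (fun z => F z * hv h k z) x =
        hvv h x * (∑ i, x i * pd i F x) + F x * (dvvv h x + hvv h x) := by
      have e : ∀ l k, x l * x k * pd l (fun z => F z * hv h k z) x =
          (x l * pd l F x) * (x k * hv h k x) + F x * (x l * x k * pd l (hv h k) x) :=
        fun l k => by rw [hp]; ring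
      simp only [e, Finset.sum_add_distrib, ← Finset.mul_sum, hvx, sum_mul_pd_hv hh hyd,
        ← Finset.sum_mul]
      ring
    have h3 : ∑ k, x k * (F x * hv h k x) = F x * hvv h x := by
      rw [← hvx, Finset.mul_sum]
      exact Finset.sum_congr rfl fun k _ => by ring
    rw [hb, h1, h2, h3]
    linear_combination F x * linMean_add_flux hh hy
  have hsU : ∀ k, SmoothOnDisc fun z => F z * hv h k z := fun k => hF.mul (smooth_hv hh k)
  have i1 : SmoothOnDisc fun y => (trh h y - hvv h y) * ∑ i, y i * pd i F y :=
    ((smooth_trh hh).sub (smooth_hvv hh)).mul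
      (SmoothOnDisc.sum fun i _ => (smoothOnDisc_coord i).mul (hF.pd i))
  have i2 : SmoothOnDisc fun y => ∑ k, bulkField F h k y * y k :=
    SmoothOnDisc.sum fun k _ => (smooth_bulkField hF hh k).mul (smoothOnDisc_coord k)
  have i3 : SmoothOnDisc fun y => ∑ k, pd k (fun z => F z * hv h k z) y - ∑ l, ∑ k, y l *
        y k * pd l (fun z => F z * hv h k z) y - (n - 1) * ∑ k, y k * (F y * hv h k y) :=
    ((SmoothOnDisc.sum fun k _ => (hsU k).pd k).sub (SmoothOnDisc.sum fun l _ =>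
      SmoothOnDisc.sum fun k _ => ((smoothOnDisc_coord l).mul (smoothOnDisc_coord k)).mul
        ((hsU k).pd l))).sub (contDiffOn_const.mul (SmoothOnDisc.sum fun k _ =>
        (smoothOnDisc_coord k).mul (hsU k)))
  rw [integralBoundary]
  simp only [hpt]
  rw [integral_sub (SmoothOnDisc.integrable_sphere (i1.sub i2)) i3.integrable_sphere,
    integral_sub i1.integrable_sphere i2.integrable_sphere, hdivU]
  ring

end pairing

/-- The equation `∇²F = -F g` for the standard metric, in the chart. -/
def IsObata (F : EuclideanSpace ℝ (Fin n) → ℝ) : Prop :=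
  ∀ y ∈ disc n, ∀ k i, pd i (pd k F) y = sg i y * pd k F y + sg k y * pd i F y -
    kd k i * (∑ l, sg l y * pd l F y + lam y ^ 2 * F y)

lemma bulk_eq_zero_of_isObata {F : EuclideanSpace ℝ (Fin n) → ℝ} (hF : IsObata F) {h : Tensor n}
    (hh : IsSmoothSymm h) {y : EuclideanSpace ℝ (Fin n)} (hy : y ∈ disc n) : bulk F h y = 0 := by
  set s := ∑ l, sg l y * pd l F y with hs
  have h1 : ∑ k, ∑ i, h y k i * (pd i (pd k F) y - 2 * sg i y * pd k F y) =
      - trh h y * (s + lam y ^ 2 * F y) := by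
    have e : ∀ k i, h y k i * (pd i (pd k F) y - 2 * sg i y * pd k F y) =
        h y k i * sg k y * pd i F y - h y k i * sg i y * pd k F y -
          (s + lam y ^ 2 * F y) * (h y k i * kd k i) := fun k i => by
      rw [hF y hy k i]; ring
    simp only [e, Finset.sum_sub_distrib, ← Finset.mul_sum, sum_mul_kd_left]
    have e2 : ∑ k, ∑ i, h y k i * sg k y * pd i F y = ∑ k, ∑ i, h y k i * sg i y * pd k F y := by
      rw [Finset.sum_comm]
      exact Finset.sum_congr rfl fun k _ => Finset.sum_congr rfl fun i _ => by
        rw [(hh.2 y hy).apply k i]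
    rw [e2, ← trh]
    ring
  have h2 : ∑ k, pd k (pd k F) y = 2 * s - n * (s + lam y ^ 2 * F y) := by
    simp only [hF y hy, Finset.sum_sub_distrib, Finset.sum_add_distrib, ← Finset.sum_mul,
      sum_kd_self, ← hs]
    ring
  rw [bulk, h1, h2]
  ring

/-- The tensor dual to the bulk term of the pairing. -/
def bulkTensor (F : EuclideanSpace ℝ (Fin n) → ℝ) : Tensor n := fun y => Matrix.of fun k i =>
  pd i (pd k F) y - sg i y * pd k F y - sg k y * pd i F y -
    kd k i * (∑ l, pd l (pd l F) y + (n - 3) * ∑ l, sg l y * pd l F y +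
      (n - 1) * lam y ^ 2 * F y)

section kernel

variable {F : EuclideanSpace ℝ (Fin n) → ℝ}

lemma smoothSymm_bulkTensor (hF : SmoothOnDisc F) : IsSmoothSymm (bulkTensor F) := by
  refine ⟨fun k i => ?_, fun y hy => ?_⟩
  · exact ((((hF.pd k).pd i).sub ((smooth_sg i).mul (hF.pd k))).sub
      ((smooth_sg k).mul (hF.pd i))).sub (contDiffOn_const.mul
      (((SmoothOnDisc.sum fun l _ => (hF.pd l).pd l).add (contDiffOn_const.mul
        (SmoothOnDisc.sum fun l _ => (smooth_sg l).mul (hF.pd l)))).add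
        ((contDiffOn_const.mul (smooth_lam.pow 2)).mul hF)))
  · refine Matrix.IsSymm.ext fun k i => ?_
    simp only [bulkTensor, Matrix.of_apply]
    rw [pd_comm i k hF hy, kd_comm i k]
    ring

lemma bulk_eq_sum_bulkTensor {h : Tensor n} (hh : IsSmoothSymm h) {y : EuclideanSpace ℝ (Fin n)}
    (hy : y ∈ disc n) : bulk F h y = ∑ k, ∑ i, h y k i * bulkTensor F y k i := by
  set S := ∑ l, pd l (pd l F) y + (n - 3) * ∑ l, sg l y * pd l F y +
      (n - 1) * lam y ^ 2 * F y with hS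
  have e : ∀ k i, h y k i * bulkTensor F y k i = h y k i * (pd i (pd k F) y -
      2 * sg i y * pd k F y) + (h y k i * sg i y * pd k F y - h y k i * sg k y * pd i F y) -
      S * (h y k i * kd k i) := fun k i => by
    simp only [bulkTensor, Matrix.of_apply, ← hS]; ring
  have e2 : ∑ k, ∑ i, h y k i * sg k y * pd i F y = ∑ k, ∑ i, h y k i * sg i y * pd k F y := by
    rw [Finset.sum_comm]
    exact Finset.sum_congr rfl fun k _ => Finset.sum_congr rfl fun i _ => by
      rw [(hh.2 y hy).apply k i]
  simp only [e, Finset.sum_sub_distrib, Finset.sum_add_distrib, ← Finset.mul_sum, sum_mul_kd_left,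
    e2]
  rw [bulk, ← hS, ← trh]
  ring

lemma isObata_of_bulkTensor_eq_zero (hn : 1 < n) (h0 : ∀ y ∈ disc n, bulkTensor F y = 0) :
    IsObata F := by
  intro y hy k i
  have he : ∀ a b, bulkTensor F y a b = 0 := fun a b => by rw [h0 y hy]; rfl
  simp only [bulkTensor, Matrix.of_apply] at he
  set tr := ∑ l, pd l (pd l F) y with htr
  set s := ∑ l, sg l y * pd l F y with hs
  have hsum : ∑ a, (pd a (pd a F) y - sg a y * pd a F y - sg a y * pd a F y -
      kd a a * (tr + (n - 3) * s + (n - 1) * lam y ^ 2 * F y)) = 0 :=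
    Finset.sum_eq_zero fun a _ => he a a
  simp only [Finset.sum_sub_distrib, ← Finset.sum_mul, sum_kd_self, ← htr, ← hs] at hsum
  have hn1 : (n : ℝ) - 1 ≠ 0 := by
    have : (1 : ℝ) < n := by exact_mod_cast hn
    linarith
  have htr' : tr = -(n - 2) * s - n * lam y ^ 2 * F y := by
    refine mul_left_cancel₀ hn1 ?_
    linear_combination -hsum
  have := he k i
  rw [htr'] at this
  linear_combination this

lemma bulkTensor_eq_zero (hF : SmoothOnDisc F)
    (hker : ∀ h : Tensor n, IsSmoothSymm h → (∫ y in disc n, wt y * bulk F h y) +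
      ∫ y : sphere (0 : EuclideanSpace ℝ (Fin n)) 1,
        (trh h y - hvv h y) * ∑ i, (y : EuclideanSpace ℝ (Fin n)) i * pd i F y
        ∂(volume : Measure (EuclideanSpace ℝ (Fin n))).toSphere = 0) :
    ∀ y ∈ disc n, bulkTensor F y = 0 := by
  have hE := smoothSymm_bulkTensor hF
  set h : Tensor n := fun y => bdf y • bulkTensor F y with hdef
  have hh : IsSmoothSymm h := ⟨fun k i => smooth_bdf.mul (hE.1 k i), fun y hy => by
    rw [hdef]; exact (hE.2 y hy).smul _⟩
  have hbd : ∀ y : sphere (0 : EuclideanSpace ℝ (Fin n)) 1,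
      h (y : EuclideanSpace ℝ (Fin n)) = 0 := by
    intro y
    have : bdf (y : EuclideanSpace ℝ (Fin n)) = 0 := by rw [bdf, norm_of_sphere]; norm_num
    simp only [hdef, this, zero_smul]
  have hk := hker h hh
  simp only [trh, hvv, hv, hbd, Matrix.zero_apply, zero_mul, Finset.sum_const_zero, mul_zero,
    sub_zero, integral_zero, add_zero] at hk
  set q : EuclideanSpace ℝ (Fin n) → ℝ := fun y => wt y * bulk F h y with hq
  have hqs : SmoothOnDisc q := smooth_wt.mul (smooth_bulk hF hh)
  have hqe : ∀ y ∈ disc n, q y = wt y * bdf y * ∑ k, ∑ i, bulkTensor F y k i ^ 2 := by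
    intro y hy
    simp only [hq]
    rw [bulk_eq_sum_bulkTensor hh hy]
    simp only [hdef, Matrix.smul_apply, smul_eq_mul, Finset.mul_sum]
    exact Finset.sum_congr rfl fun k _ => Finset.sum_congr rfl fun i _ => by ring
  have hnn : ∀ y ∈ disc n, 0 ≤ q y := by
    intro y hy
    have h1 : ‖y‖ ≤ 1 := by simpa using hy
    have h2 : 0 ≤ bdf y := by rw [bdf]; nlinarith [norm_nonneg y]
    rw [hqe y hy]
    exact mul_nonneg (mul_nonneg (wt_pos y).le h2)
      (Finset.sum_nonneg fun k _ => Finset.sum_nonneg fun i _ => sq_nonneg _)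
  have hae : q =ᵐ[volume.restrict (disc n)] 0 :=
    (setIntegral_eq_zero_iff_of_nonneg_ae
      (by filter_upwards [ae_restrict_mem measurableSet_closedBall] with y hy using hnn y hy)
      hqs.integrableOn).mp hk
  have hball : Set.EqOn q 0 (ball 0 1) :=
    Measure.eqOn_open_of_ae_eq (ae_restrict_of_ae_restrict_of_subset ball_subset_closedBall hae)
      isOpen_ball (hqs.continuousOn.mono ball_subset_closedBall) continuousOn_const
  have hEball : ∀ y ∈ ball (0 : EuclideanSpace ℝ (Fin n)) 1, ∀ k i, bulkTensor F y k i = 0 := by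
    intro y hy k i
    have h1 : ‖y‖ < 1 := by simpa using hy
    have h2 : 0 < bdf y := by rw [bdf]; nlinarith [norm_nonneg y]
    have h3 := hball hy
    rw [hqe y (ball_subset_closedBall hy), Pi.zero_apply] at h3
    have h4 := (mul_eq_zero.mp h3).resolve_left (mul_pos (wt_pos y) h2).ne'
    have h5 := (Finset.sum_eq_zero_iff_of_nonneg
      (fun k _ => Finset.sum_nonneg fun i _ => sq_nonneg _)).mp h4 k (Finset.mem_univ _)
    have h6 := (Finset.sum_eq_zero_iff_of_nonneg
      (fun i _ => sq_nonneg _)).mp h5 i (Finset.mem_univ _)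
    exact pow_eq_zero_iff two_ne_zero |>.mp h6
  intro y hy
  ext k i
  have hcl : disc n ⊆ closure (ball (0 : EuclideanSpace ℝ (Fin n)) 1) := by
    rw [closure_ball _ one_ne_zero]
  exact Set.EqOn.of_subset_closure (f := fun y => bulkTensor F y k i) (g := fun _ => 0)
    (fun z hz => hEball z hz k i) (hE.1 k i).continuousOn continuousOn_const ball_subset_closedBall
    hcl hy

lemma eq_of_pd_eq_zero {u : EuclideanSpace ℝ (Fin n) → ℝ} (hu : SmoothOnDisc u)
    (h0 : ∀ y ∈ disc n, ∀ i, pd i u y = 0) {y : EuclideanSpace ℝ (Fin n)} (hy : y ∈ disc n) :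
    u y = u 0 := by
  refine (convex_closedBall (0 : EuclideanSpace ℝ (Fin n)) 1).is_const_of_fderivWithin_eq_zero
    (𝕜 := ℝ) (hu.differentiableOn (by simp)) (fun z hz => ?_) hy (by simp)
  ext v
  rw [fderivWithin_apply_eq_sum]
  simp [h0 z hz]

/-- A function on the ball with pure-trace Hessian is a quadratic polynomial. -/
lemma eq_quadratic_of_hessian_eq (hn : 1 < n) {P G : EuclideanSpace ℝ (Fin n) → ℝ}
    (hP : SmoothOnDisc P) (hG : SmoothOnDisc G)
    (hPG : ∀ y ∈ disc n, ∀ i j, pd j (pd i P) y = kd i j * G y) :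
    ∃ (b : Fin n → ℝ) (d : ℝ), ∀ y ∈ disc n, P y = G 0 * mu y + ∑ j, b j * y j + d := by
  have hGpd : ∀ y ∈ disc n, ∀ i, pd i G y = 0 := by
    intro y hy i
    obtain ⟨j, hj⟩ : ∃ j : Fin n, j ≠ i :=
      haveI : Nontrivial (Fin n) := Fin.nontrivial_iff_two_le.mpr hn
      exists_ne i
    have h1 : pd i G y = pd i (pd j (pd j P)) y :=
      pd_congr (fun z hz => by rw [hPG z hz, kd_self, one_mul]) i hy
    rw [h1, pd_comm i j (hP.pd j) hy,
      pd_congr (v := fun _ => 0) (fun z hz => by rw [hPG z hz]; simp [kd, hj]) j hy, pd_const]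
  have hGc : ∀ y ∈ disc n, G y = G 0 := fun y hy => eq_of_pd_eq_zero hG hGpd hy
  have hPi : ∀ i, ∀ y ∈ disc n, pd i P y = G 0 * y i + pd i P 0 := by
    intro i y hy
    have hs : SmoothOnDisc fun y : EuclideanSpace ℝ (Fin n) => pd i P y - G 0 * y i :=
      (hP.pd i).sub (contDiffOn_const.mul (smoothOnDisc_coord i))
    have := eq_of_pd_eq_zero hs (fun z hz j => by
      rw [pd_sub j (hP.pd i) (contDiffOn_const.mul (smoothOnDisc_coord i)) hz,
        pd_const_mul j _ (smoothOnDisc_coord i) hz, pd_coord j i hz, hPG z hz, hGc z hz,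
        kd_comm, kd]
      ring) hy
    simp only [PiLp.zero_apply, mul_zero, sub_zero] at this
    linarith
  refine ⟨fun i => pd i P 0, P 0 - G 0 * mu (0 : EuclideanSpace ℝ (Fin n)), fun y hy => ?_⟩
  have hl : ∀ j ∈ Finset.univ, SmoothOnDisc fun y : EuclideanSpace ℝ (Fin n) => pd j P 0 * y j :=
    fun j _ => contDiffOn_const.mul (smoothOnDisc_coord j)
  have hm : SmoothOnDisc fun y : EuclideanSpace ℝ (Fin n) => G 0 * mu y :=
    contDiffOn_const.mul smooth_mu
  have := eq_of_pd_eq_zero (u := fun y => P y - (G 0 * mu y + ∑ j, pd j P 0 * y j))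
    (hP.sub (hm.add (SmoothOnDisc.sum hl))) (fun z hz i => by
      rw [pd_sub i hP (hm.add (SmoothOnDisc.sum hl)) hz, pd_add i hm (SmoothOnDisc.sum hl) hz,
        pd_const_mul i _ smooth_mu hz, pd_mu i hz, pd_sum _ i hl hz, hPi i z hz]
      simp only [pd_const_mul i _ (smoothOnDisc_coord _) hz, pd_coord _ _ hz]
      simp) hy
  simp only [PiLp.zero_apply, mul_zero, Finset.sum_const_zero, add_zero] at this
  linarith

lemma lam_zero : lam (0 : EuclideanSpace ℝ (Fin n)) = 2 := by simp [lam]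

/-- Solutions of the Obata equation are restrictions of linear functions. -/
lemma eq_linear_of_isObata (hn : 1 < n) (hF : SmoothOnDisc F) (hO : IsObata F) :
    ∃ (b : Fin n → ℝ) (d : ℝ), ∀ y ∈ disc n,
      F y = lam y * (∑ j, b j * y j) + d * (lam y - 1) := by
  set G : EuclideanSpace ℝ (Fin n) → ℝ :=
    fun y => F y + ∑ l, y l * pd l F y - lam y * F y with hGdef
  have hG : SmoothOnDisc G := (hF.add (SmoothOnDisc.sum fun l _ =>
    (smoothOnDisc_coord l).mul (hF.pd l))).sub (smooth_lam.mul hF)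
  have hP : SmoothOnDisc fun y => mu y * F y := smooth_mu.mul hF
  have hP1 : ∀ i, ∀ y ∈ disc n, pd i (fun y => mu y * F y) y = y i * F y + mu y * pd i F y := by
    intro i y hy
    rw [pd_mul i smooth_mu hF hy, pd_mu i hy]
  have hPG : ∀ y ∈ disc n, ∀ i j, pd j (pd i (fun y => mu y * F y)) y = kd i j * G y := by
    intro y hy i j
    rw [pd_congr (hP1 i) j hy, pd_add j ((smoothOnDisc_coord i).mul hF) (smooth_mu.mul (hF.pd i)) hy,
      pd_mul j (smoothOnDisc_coord i) hF hy, pd_mul j smooth_mu (hF.pd i) hy, pd_coord j i hy,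
      pd_mu j hy, hO y hy i j, ← kd, kd_comm j i, hGdef]
    have hs : ∑ l, sg l y * pd l F y = - lam y * ∑ l, y l * pd l F y := by
      rw [Finset.mul_sum]
      exact Finset.sum_congr rfl fun l _ => by rw [sg]; ring
    rw [hs, sg, sg]
    linear_combination (- y j * pd i F y - y i * pd j F y + kd i j * (∑ l, y l * pd l F y) -
      kd i j * lam y * F y) * lam_mul_mu y
  obtain ⟨b, d, hbd⟩ := eq_quadratic_of_hessian_eq hn hP hG hPG
  have hF' : ∀ y ∈ disc n, F y = G 0 + lam y * (∑ j, b j * y j) + d * lam y := by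
    intro y hy
    linear_combination lam y * hbd y hy + (G 0 - F y) * lam_mul_mu y
  have h0 := hF' 0 (by simp)
  have hG0 : G 0 = - F 0 := by
    simp only [hGdef, PiLp.zero_apply, zero_mul, Finset.sum_const_zero, add_zero, lam_zero]
    ring
  simp only [PiLp.zero_apply, mul_zero, Finset.sum_const_zero, lam_zero, add_zero] at h0
  have hGd : G 0 = - d := by linarith
  exact ⟨b, d, fun y hy => by rw [hF' y hy, hGd]; ring⟩

lemma pd_lam_mul_linear (b : Fin n → ℝ) {y : EuclideanSpace ℝ (Fin n)} (hy : y ∈ disc n)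
    (k : Fin n) : pd k (fun y => lam y * ∑ j, b j * y j) y =
      sg k y * (lam y * ∑ j, b j * y j) + lam y * b k := by
  have hl : ∀ j ∈ Finset.univ, SmoothOnDisc fun y : EuclideanSpace ℝ (Fin n) => b j * y j :=
    fun j _ => contDiffOn_const.mul (smoothOnDisc_coord j)
  rw [pd_mul k smooth_lam (SmoothOnDisc.sum hl) hy, pd_lam k hy, pd_sum _ k hl hy]
  simp only [pd_const_mul k _ (smoothOnDisc_coord _) hy, pd_coord _ _ hy, sg]
  simp
  ring

lemma smooth_lam_mul_linear (b : Fin n → ℝ) :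
    SmoothOnDisc fun y : EuclideanSpace ℝ (Fin n) => lam y * ∑ j, b j * y j :=
  smooth_lam.mul (SmoothOnDisc.sum fun j _ => contDiffOn_const.mul (smoothOnDisc_coord j))

lemma isObata_lam_mul_linear (b : Fin n → ℝ) :
    IsObata fun y : EuclideanSpace ℝ (Fin n) => lam y * ∑ j, b j * y j := by
  intro y hy k i
  have hsm := smooth_lam_mul_linear b
  have hr : lam y * (1 + ‖y‖ ^ 2) = 2 := by
    have : 0 < 1 + ‖y‖ ^ 2 := by positivity
    rw [lam]; field_simp
  have hpl : pd i lam y = sg i y * lam y := by rw [pd_lam i hy, sg]; ring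
  rw [pd_congr (fun z hz => pd_lam_mul_linear b hz k) i hy,
    pd_add i ((smooth_sg k).mul hsm) (smooth_lam.mul contDiffOn_const) hy,
    pd_mul i (smooth_sg k) hsm hy, pd_mul i smooth_lam contDiffOn_const hy, pd_const,
    pd_sg k i hy, hpl]
  simp only [pd_lam_mul_linear b hy]
  have hs : ∑ l, sg l y * (sg l y * (lam y * ∑ j, b j * y j) + lam y * b l) =
      lam y ^ 2 * ‖y‖ ^ 2 * (lam y * ∑ j, b j * y j) - lam y ^ 2 * ∑ j, b j * y j := by
    have e : lam y ^ 2 * ∑ j, b j * y j = ∑ j, lam y ^ 2 * (b j * y j) := Finset.mul_sum ..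
    rw [e]
    generalize lam y * ∑ j, b j * y j = W
    rw [← sum_sg_sq, Finset.sum_mul, ← Finset.sum_sub_distrib]
    exact Finset.sum_congr rfl fun l _ => by simp only [sg]; ring
  rw [hs]
  linear_combination (kd k i * lam y ^ 2 * ∑ j, b j * y j) * hr

end kernel

lemma inChart_of_mem (f : upper n → ℝ) {y : EuclideanSpace ℝ (Fin n)} (hy : y ∈ disc n) :
    inChart f y = f ⟨param n y, param_mem hy⟩ := by
  simp only [inChart]
  exact dif_pos hy

/-- Membership in the kernel, with the pairing integrated by parts. -/
lemma mem_kerAdjoint_iff (hn : 0 < n) (f : upper n → ℝ) :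
    f ∈ kerAdjoint (standardMetric n) ↔ SmoothOnDisc (inChart f) ∧
      ∀ h : Tensor n, IsSmoothSymm h → (∫ y in disc n, wt y * bulk (inChart f) h y) +
        ∫ y : sphere (0 : EuclideanSpace ℝ (Fin n)) 1,
          (trh h y - hvv h y) * ∑ i, (y : EuclideanSpace ℝ (Fin n)) i * pd i (inChart f) y
          ∂(volume : Measure (EuclideanSpace ℝ (Fin n))).toSphere = 0 := by
  have h0 : IsSmoothSymm (0 : Tensor n) :=
    ⟨fun _ _ => contDiffOn_const, fun _ _ => Matrix.transpose_zero⟩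
  have hM : ∀ h : Tensor n, integralM (standardMetric n) (innerM (standardMetric n) h 0) = 0 := by
    intro h; simp [integralM, innerM]
  have hB : ∀ h : Tensor n,
      integralBoundary (standardMetric n) (innerBoundary (standardMetric n) h 0) = 0 := by
    intro h; simp [integralBoundary, innerBoundary]
  constructor
  · rintro ⟨hf, -, -, hker⟩
    refine ⟨hf, fun h hh => ?_⟩
    rw [← integral_pairing hn hf hh, hker h hh, hM, hB, add_zero]
  · rintro ⟨hf, hker⟩
    refine ⟨hf, h0, h0, fun h hh => ?_⟩
    rw [integral_pairing hn hf hh, hker h hh, hM, hB, add_zero]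

lemma sum_mul_pd_lam_mul_linear (b : Fin n → ℝ) {y : EuclideanSpace ℝ (Fin n)} (hy : ‖y‖ = 1) :
    ∑ i, y i * pd i (fun y => lam y * ∑ j, b j * y j) y = 0 := by
  have hsq : ∑ k, y k * y k = 1 := by rw [sum_sq, hy]; norm_num
  simp only [pd_lam_mul_linear b (mem_disc_of_norm hy), sg_of_norm hy, lam_eq_one_of_norm hy]
  have e : ∀ i, y i * (-y i * (1 * ∑ j, b j * y j) + 1 * b i) =
      b i * y i - (y i * y i) * ∑ j, b j * y j := fun i => by ring
  simp only [e, Finset.sum_sub_distrib, ← Finset.sum_mul, hsq]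
  ring

lemma mem_kerAdjoint_of_linear (hn : 0 < n) {f : upper n → ℝ} (b : Fin n → ℝ)
    (hf : ∀ y ∈ disc n, inChart f y = lam y * ∑ j, b j * y j) :
    f ∈ kerAdjoint (standardMetric n) := by
  rw [mem_kerAdjoint_iff hn]
  have hs : SmoothOnDisc (inChart f) := (smooth_lam_mul_linear b).congr hf
  have hp : ∀ i, ∀ y ∈ disc n, pd i (inChart f) y = pd i (fun y => lam y * ∑ j, b j * y j) y :=
    fun i y hy => pd_congr hf i hy
  have hO : IsObata (inChart f) := by
    intro y hy k i
    rw [pd_congr (hp k) i hy, isObata_lam_mul_linear b y hy k i]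
    simp only [hp _ y hy, hf y hy]
  refine ⟨hs, fun h hh => ?_⟩
  have h1 : ∫ y in disc n, wt y * bulk (inChart f) h y = 0 := by
    rw [setIntegral_congr_fun (g := fun _ => (0 : ℝ)) measurableSet_closedBall fun y hy => by
      simp only [bulk_eq_zero_of_isObata hO hh hy, mul_zero]]
    simp
  have h2 : ∀ y : sphere (0 : EuclideanSpace ℝ (Fin n)) 1,
      ∑ i, (y : EuclideanSpace ℝ (Fin n)) i * pd i (inChart f) y = 0 := by
    intro y
    simp only [hp _ _ (mem_disc_of_sphere y)]
    exact sum_mul_pd_lam_mul_linear b (norm_of_sphere y)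
  simp only [h1, h2, mul_zero, integral_zero, add_zero]

lemma linear_of_mem_kerAdjoint (hn : 1 < n) {f : upper n → ℝ}
    (hf : f ∈ kerAdjoint (standardMetric n)) :
    ∃ b : Fin n → ℝ, ∀ y ∈ disc n, inChart f y = lam y * ∑ j, b j * y j := by
  have hn0 : 0 < n := by omega
  obtain ⟨hs, hker⟩ := (mem_kerAdjoint_iff hn0 f).mp hf
  have hO := isObata_of_bulkTensor_eq_zero hn (bulkTensor_eq_zero hs hker)
  obtain ⟨b, d, hbd⟩ := eq_linear_of_isObata hn hs hO
  refine ⟨b, fun y hy => ?_⟩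
  suffices hd : d = 0 by rw [hbd y hy, hd, zero_mul, add_zero]
  have hone : IsSmoothSymm (fun _ => 1 : Tensor n) :=
    ⟨fun _ _ => contDiffOn_const, fun _ _ => Matrix.isSymm_one⟩
  have hk := hker _ hone
  have h1 : ∫ y in disc n, wt y * bulk (inChart f) (fun _ => 1) y = 0 := by
    rw [setIntegral_congr_fun (g := fun _ => (0 : ℝ)) measurableSet_closedBall fun y hy => by
      simp only [bulk_eq_zero_of_isObata hO hone hy, mul_zero]]
    simp
  have h2 : ∀ y : sphere (0 : EuclideanSpace ℝ (Fin n)) 1,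
      (trh (fun _ => 1 : Tensor n) y - hvv (fun _ => 1 : Tensor n) y) *
        ∑ i, (y : EuclideanSpace ℝ (Fin n)) i * pd i (inChart f) y = (n - 1) * (-d) := by
    intro y
    have hy := norm_of_sphere y
    have hyd := mem_disc_of_sphere y
    generalize (y : EuclideanSpace ℝ (Fin n)) = x at hy hyd ⊢
    have hsq : ∑ k, x k * x k = 1 := by rw [sum_sq, hy]; norm_num
    have ht : trh (fun _ => 1 : Tensor n) x = n := by simp [trh]
    have hvx : hvv (fun _ => 1 : Tensor n) x = 1 := by
      simp only [hvv, hv, Matrix.one_apply, ite_mul, one_mul, zero_mul, Finset.sum_ite_eq,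
        Finset.mem_univ, if_true, hsq]
    have hp : ∀ i, pd i (inChart f) x =
        pd i (fun y => lam y * ∑ j, b j * y j) x - d * x i := by
      intro i
      rw [pd_congr hbd i hyd, pd_add i (smooth_lam_mul_linear b)
        (contDiffOn_const.mul (smooth_lam.sub contDiffOn_const)) hyd,
        pd_const_mul i d (smooth_lam.sub contDiffOn_const) hyd,
        pd_sub i smooth_lam contDiffOn_const hyd, pd_const, pd_lam i hyd, lam_eq_one_of_norm hy]
      ring
    have e : ∀ i, x i * pd i (inChart f) x =
        x i * pd i (fun y => lam y * ∑ j, b j * y j) x - d * (x i * x i) := fun i => by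
      rw [hp]; ring
    simp only [e, Finset.sum_sub_distrib, ← Finset.mul_sum, hsq, sum_mul_pd_lam_mul_linear b hy,
      ht, hvx]
    ring
  simp only [h1, h2, integral_const, zero_add, smul_eq_mul] at hk
  have : Nonempty (Fin n) := ⟨⟨0, hn0⟩⟩
  have hvol : (volume : Measure (EuclideanSpace ℝ (Fin n))).toSphere.real Set.univ ≠ 0 := by
    have : Nonempty (sphere (0 : EuclideanSpace ℝ (Fin n)) 1) :=
      ⟨⟨EuclideanSpace.single ⟨0, hn0⟩ 1, by simp⟩⟩
    rw [measureReal_ne_zero_iff]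
    exact (Measure.measure_univ_pos.mpr (NeZero.ne _)).ne'
  have hn1 : (n : ℝ) - 1 ≠ 0 := by
    have : (1 : ℝ) < n := by exact_mod_cast hn
    linarith
  have h3 := (mul_eq_zero.mp ((mul_eq_zero.mp hk).resolve_left hvol)).resolve_left hn1
  linarith

lemma inChart_linear (b : Fin n → ℝ) {y : EuclideanSpace ℝ (Fin n)} (hy : y ∈ disc n) :
    inChart (∑ i, b i • coord i) y = lam y * ∑ j, b j * y j := by
  rw [inChart_of_mem _ hy, Finset.sum_apply, Finset.mul_sum]
  refine Finset.sum_congr rfl fun i _ => ?_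
  simp only [Pi.smul_apply, coord, param_castSucc, smul_eq_mul, lam]
  ring

lemma eq_of_inChart_eq {f g : upper n → ℝ} (h : ∀ y ∈ disc n, inChart f y = inChart g y) :
    f = g := by
  ext ⟨x, hx⟩
  obtain ⟨y, hy, rfl⟩ := (param_bijOn n).surjOn hx
  have := h y hy
  rwa [inChart_of_mem _ hy, inChart_of_mem _ hy] at this

lemma coord_ne_zero (i : Fin n) : coord i ≠ 0 := by
  intro h
  have hy : (EuclideanSpace.single i 1 : EuclideanSpace ℝ (Fin n)) ∈ disc n := by simp
  have := congrFun h ⟨param n (EuclideanSpace.single i 1), param_mem hy⟩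
  simp only [coord, param_castSucc, Pi.zero_apply] at this
  norm_num at this

end Hemisphere

end

theorem proposition4p1 (n : ℕ) (hn : 3 ≤ n) :
    Hemisphere.IsSingular (Hemisphere.standardMetric n) ∧
      Hemisphere.kerAdjoint (Hemisphere.standardMetric n) =
        (Submodule.span ℝ (Set.range (Hemisphere.coord (n := n))) :
          Set (Hemisphere.upper n → ℝ)) := by
  have hker : Hemisphere.kerAdjoint (Hemisphere.standardMetric n) =
        (Submodule.span ℝ (Set.range (Hemisphere.coord (n := n))) :
          Set (Hemisphere.upper n → ℝ)) := by
    ext f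
    rw [SetLike.mem_coe, Submodule.mem_span_range_iff_exists_fun]
    constructor
    · intro hf
      obtain ⟨b, hb⟩ := Hemisphere.linear_of_mem_kerAdjoint (by omega) hf
      exact ⟨b, Hemisphere.eq_of_inChart_eq fun y hy => by
        rw [Hemisphere.inChart_linear b hy, hb y hy]⟩
    · rintro ⟨b, rfl⟩
      exact Hemisphere.mem_kerAdjoint_of_linear (by omega) b
        fun y hy => Hemisphere.inChart_linear b hy
  refine ⟨⟨Hemisphere.coord ⟨0, by omega⟩, ?_, Hemisphere.coord_ne_zero _⟩, hker⟩
  rw [hker]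
  exact Submodule.subset_span ⟨_, rfl⟩
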